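/- **Setting.** Let $d\ge 1$ and let $\|\cdot\|_\infty$ denote the maximum norm on $\mathbb R^d$ and also the sup-norm of functions on $[0,1]^d$. For $\alpha>0$ put $\lfloor\alpha\rfloor=\max\{k\in\mathbb N_0: k<\alpha\}$. The Hölder class $\mathcal H(\alpha,L)$ consists of the functions $f:[0,1]^d\to\mathbb R$ that are $\lfloor\alpha\rfloor$ times continuously differentiable, with derivatives continuous up to the boundary, and satisfy $$\|f\|_{\mathcal H,\alpha}=\max_{|r|\le\lfloor\alpha\rfloor}\sup_{x}|\partial^r f(x)|+\max_{|r|=\lfloor\alpha\rfloor}\sup_{x\ne y}\frac{|\partial^r f(x)-\partial^r f(y)|}{\|x-y\|_\infty^{\alpha-\lfloor\alpha\rfloor}}\le L .$$ $\mathcal P(\beta,C_Z)$ is the class of processes $Z$ on $[0,1]^d$ whose paths are almost surely $\lfloor\beta\rfloor$ times continuously differentiable with $\|Z\|_{\mathcal H,\beta}\le M$ a.s. for a random variable $M$ with $\mathbb E[M^2]\le C_Z$. **Model.** For $p=(p_1,\dots,p_d)$ write $p_{\min}=\min_k p_k$ and $p^{\mathbf 1}=\prod_k p_k$. The design points are $x_j=(x_{1,j_1},\dots,x_{d,j_d})\in[0,1]^d$,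 $\mathbf 1\le j\le p$, with $x_{k,l}<x_{k,l+1}$. One observes $$Y_{i,j}=\mu(x_j)+Z_i(x_j)+\varepsilon_{i,j},\qquad 1\le i\le n,\ \mathbf 1\le j\le p,$$ where $Z_1,\dots,Z_n$ are i.i.d. centered processes in $\mathcal P(\beta,C_Z)$, and the errors $\varepsilon_{i,j}$ are centered, independent, independent of $(Z_1,\dots,Z_n)$, and sub-Gaussian with variance proxy $\zeta^2\sigma_{i,j}^2$, that is $\mathbb E\,e^{t\varepsilon_{i,j}}\le e^{\zeta^2\sigma_{i,j}^2t^2/2}$ for all $t\in\mathbb R$, where $\sigma_{i,j}^2=\mathbb E[\varepsilon_{i,j}^2]\le\sigma^2$. The design is *regular* with constant $C_d$: for all $x\in[0,1]^d$ and all $h\ge 1/p_{\min}$, the number of $j$ with $\|x_j-x\|_\infty\le h$ is at most $C_d\,h^d\,p^{\mathbf 1}$. **Estimator.** Let $s\in\mathbb N_0^d$ with $|s|\le\lfloor\alpha\rfloor$. Consider linear estimators of $\partial^s\mu$, $$\hat\mu^{(s)}_{n,p,h}(x)=\sum_{\mathbf 1\le j\le p} w_j(x;h)\,\bar Y_j,\qquad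 \bar Y_j=\frac1n\sum_{i=1}^n Y_{i,j},$$ with deterministic weights that satisfy, for all $h\in(c/p_{\min},h_0]$ and all $x,y\in[0,1]^d$: - (M1) $\sum_j (x_j-x)^r\,w_j(x;h)=\delta_{r,s}\,s!$ for all $r\in\mathbb N_0^d$ with $|r|\le\lfloor\alpha\rfloor$; - (M2) $w_j(x;h)=0$ if $\|x-x_j\|_\infty>h$; - (M3) $|w_j(x;h)|\le \dfrac{C_1}{p^{\mathbf 1}h^{d+|s|}}$ for all $j$; - (M4) $|w_j(x;h)-w_j(y;h)|\le \dfrac{C_2}{p^{\mathbf 1}h^{d+|s|}}\,\min\!\Big(\dfrac{\|x-y\|_\infty}{h},\,1\Big)$ for all $j$. **Theorem (upper bounds).** Let $\alpha,\beta,L,C_Z,\zeta,c,C_1,C_2,C_d>0$, $\sigma\ge0$, $0<h_0\le1$, $0<\beta_1<\beta$ and $s\in\mathbb N_0^d$ with $|s|\le\lfloor\alpha\rfloor$ be fixed, and put $\kappa=\min(|s|,\beta_1)$. There are $C>0$ and $n_0,p_0\in\mathbb N$, depending only on these quantities and $d$, such that for all $n\ge n_0$, all $p$ with $p_{\min}\ge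 p_0$, all regular designs with constant $C_d$, all weights satisfying (M1)–(M4), and all processes and errors as above, $$\sup_{h\in(c/p_{\min},h_0]}\ \sup_{Z\in\mathcal P(\beta,C_Z),\ \mu\in\mathcal H(\alpha,L)} a_{n,p,h}^{-1}\ \mathbb E_{\mu,Z}\Big[\big\|\hat\mu^{(s)}_{n,p,h}-\partial^s\mu\big\|_\infty\Big]\le C,$$ where $$a_{n,p,h}=\max\Big(L\,h^{\alpha-|s|},\ \zeta\,\sigma\sqrt{\frac{\log(h^{-1})}{n\,p^{\mathbf 1}\,h^{d+2|s|}}},\ \frac{C_Z}{\sqrt n\,h^{|s|-\kappa}}\Big).$$ -/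

import Mathlib

open MeasureTheory ProbabilityTheory
open scoped ENNReal Nat

noncomputable section

/-- The closed unit cube `[0,1]^d`. The norm of `Fin d → ℝ` is the maximum norm. -/
def unitCube (d : ℕ) : Set (Fin d → ℝ) := Set.Icc 0 1

/-- The length `|s| = s₁ + ... + s_d` of a multi-index. -/
abbrev multiLength {d : ℕ} (s : Fin d → ℕ) : ℕ := ∑ i, s i

/-- The largest nonnegative integer that is strictly smaller than `α` (for `α > 0`). -/
def strictFloor (α : ℝ) : ℕ := ⌈α⌉₊ - 1

theorem le_strictFloor_iff {α : ℝ} (hα : 0 < α) (k : ℕ) : k ≤ strictFloor α ↔ (k : ℝ) < α := by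
  have h : 0 < ⌈α⌉₊ := Nat.ceil_pos.2 hα
  rw [← Nat.lt_ceil, strictFloor]
  omega

/-- The partial derivative `∂^s f (x) = ∂₁^{s₁} ... ∂_d^{s_d} f (x)` on the unit cube: the
derivative of order `|s|`, applied to `s i` copies of the `i`-th unit vector for each `i`.
At boundary points of the cube the derivative is taken within the cube. -/
def partialDeriv {d : ℕ} (s : Fin d → ℕ) (f : (Fin d → ℝ) → ℝ) (x : Fin d → ℝ) : ℝ :=
  iteratedFDerivWithin ℝ (multiLength s) f (unitCube d) x
    (fun l => Pi.single (finSigmaFinEquiv.symm l).1 1)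

/-- The Hölder norm of index `α` on the unit cube, with values in `[0,∞]`. -/
def holderNorm {d : ℕ} (α : ℝ) (f : (Fin d → ℝ) → ℝ) : ℝ≥0∞ :=
  (⨆ r : Fin d → ℕ, ⨆ _ : multiLength r ≤ strictFloor α, ⨆ x ∈ unitCube d,
      ENNReal.ofReal |partialDeriv r f x|) +
  ⨆ r : Fin d → ℕ, ⨆ _ : multiLength r = strictFloor α, ⨆ x ∈ unitCube d, ⨆ y ∈ unitCube d,
      ⨆ _ : x ≠ y, ENNReal.ofReal
        (|partialDeriv r f x - partialDeriv r f y| / ‖x - y‖ ^ (α - strictFloor α))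

/-- `f` is `⌊α⌋` times continuously differentiable on the cube, derivatives being continuous up
to the boundary, with Hölder norm at most `L`. -/
def HolderClass {d : ℕ} (α L : ℝ) (f : (Fin d → ℝ) → ℝ) : Prop :=
  ContDiffOn ℝ (strictFloor α) f (unitCube d) ∧ holderNorm α f ≤ ENNReal.ofReal L

/-- The class of processes on `[0,1]^d` (with paths `Z ω`) whose paths almost surely have Hölder
norm of index `β` at most `M`, for a random variable `M` with `E[M²] ≤ C_Z`. -/
def ProcessClass {d : ℕ} {Ω : Type*} [MeasurableSpace Ω] (P : Measure Ω) (β CZ : ℝ)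
    (Z : Ω → (Fin d → ℝ) → ℝ) : Prop :=
  (∀ x ∈ unitCube d, Measurable fun ω => Z ω x) ∧
  ∃ M : Ω → ℝ, MemLp M 2 P ∧ ∫ ω, M ω ^ 2 ∂P ≤ CZ ∧ ∀ᵐ ω ∂P, HolderClass β (M ω) (Z ω)

/-- The set of multi-indices `𝟏 ≤ j ≤ p`, counted from zero. -/
abbrev GridIndex {d : ℕ} (p : Fin d → ℕ) : Type := (k : Fin d) → Fin (p k)

/-- The number of points of the grid, `p₁ ⋯ p_d`. -/
def gridSize {d : ℕ} (p : Fin d → ℕ) : ℕ := ∏ k, p k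

/-- The smallest component of `p` (for `d ≥ 1`). -/
def pMin {d : ℕ} (p : Fin d → ℕ) : ℕ := ⨅ k, p k

/-- The design point `x_j = (x_{1,j₁}, ..., x_{d,j_d})` of the Cartesian product grid. -/
def gridPoint {d : ℕ} {p : Fin d → ℕ} (x : (k : Fin d) → Fin (p k) → ℝ) (j : GridIndex p) :
    Fin d → ℝ := fun k => x k (j k)

/-- Regular design: strictly ordered coordinates in `[0,1]`, and every cube of half side length
`h ≥ 1 / p_min` around a point of `[0,1]^d` contains at most `C_d h^d p₁ ⋯ p_d` design points. -/
structure RegularDesign {d : ℕ} {p : Fin d → ℕ} (Cd : ℝ)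
    (x : (k : Fin d) → Fin (p k) → ℝ) : Prop where
  mem_unit : ∀ k l, x k l ∈ Set.Icc (0 : ℝ) 1
  strictMono : ∀ k, StrictMono (x k)
  card_le : ∀ y ∈ unitCube d, ∀ h : ℝ, 0 < h → 1 / (pMin p : ℝ) ≤ h →
    ({j : GridIndex p | (fun k => y k - h) ≤ gridPoint x j ∧
        gridPoint x j ≤ fun k => y k + h}.ncard : ℝ) ≤ Cd * h ^ d * gridSize p

/-- The conditions on weights `w h y j` of a linear estimator of the derivative `∂^s`, for
all bandwidths `h` in `(c / p_min, h₀]`: they reproduce the derivative of polynomials of degree at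
most `m`, localize, are bounded, and are Lipschitz continuous. -/
structure WeightConditions {d : ℕ} {p : Fin d → ℕ} (x : (k : Fin d) → Fin (p k) → ℝ)
    (s : Fin d → ℕ) (m : ℕ) (c h₀ C₁ C₂ : ℝ)
    (w : ℝ → (Fin d → ℝ) → GridIndex p → ℝ) : Prop where
  reproduce : ∀ h : ℝ, c / pMin p < h → h ≤ h₀ → ∀ y ∈ unitCube d,
    ∀ r : Fin d → ℕ, multiLength r ≤ m →
      ∑ j, (∏ k, (gridPoint x j k - y k) ^ r k) * w h y j =
        if r = s then ((∏ k, (s k)! : ℕ) : ℝ) else 0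
  localize : ∀ h : ℝ, c / pMin p < h → h ≤ h₀ → ∀ y ∈ unitCube d, ∀ j,
    h < ‖y - gridPoint x j‖ → w h y j = 0
  bounded : ∀ h : ℝ, c / pMin p < h → h ≤ h₀ → ∀ y ∈ unitCube d, ∀ j,
    |w h y j| ≤ C₁ / (gridSize p * h ^ (d + multiLength s))
  lipschitz : ∀ h : ℝ, c / pMin p < h → h ≤ h₀ → ∀ y ∈ unitCube d, ∀ z ∈ unitCube d, ∀ j,
    |w h y j - w h z j| ≤ C₂ / (gridSize p * h ^ (d + multiLength s)) * min (‖y - z‖ / h) 1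

/-- The stochastic part of the model: `n` independent, identically distributed, centered processes
`Z i` in the class `𝒫(β, C_Z)`, and errors `ε i j` that are independent, independent of the
processes, centered, and sub-Gaussian with variance proxy `ζ² σ_{ij}²`, where the variances
`σ_{ij}² = E[ε_{ij}²]` are at most `σ²`. -/
structure FunctionalNoise {d n : ℕ} {p : Fin d → ℕ} {Ω : Type*} [MeasurableSpace Ω]
    (P : Measure Ω) (β CZ ζ σ : ℝ) (Z : Fin n → Ω → (Fin d → ℝ) → ℝ)
    (ε : Fin n → GridIndex p → Ω → ℝ) : Prop where
  process_mem : ∀ i, ProcessClass P β CZ (Z i)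
  process_centered : ∀ i, ∀ x ∈ unitCube d, ∫ ω, Z i ω x ∂P = 0
  process_indep : iIndepFun (fun i ω (x : unitCube d) => Z i ω x) P
  process_identDistrib : ∀ i i', IdentDistrib (fun ω (x : unitCube d) => Z i ω x)
    (fun ω (x : unitCube d) => Z i' ω x) P P
  error_measurable : ∀ i j, Measurable (ε i j)
  error_indep : iIndepFun (fun (a : Fin n × GridIndex p) ω => ε a.1 a.2 ω) P
  error_indep_process : IndepFun (fun ω (a : Fin n × GridIndex p) => ε a.1 a.2 ω)
    (fun ω (a : Fin n × unitCube d) => Z a.1 ω a.2) P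
  error_centered : ∀ i j, ∫ ω, ε i j ω ∂P = 0
  error_variance_le : ∀ i j, ∫ ω, ε i j ω ^ 2 ∂P ≤ σ ^ 2
  error_subGaussian : ∀ i j,
    HasSubgaussianMGF (ε i j) (Real.toNNReal (ζ ^ 2 * ∫ ω, ε i j ω ^ 2 ∂P)) P

/-- The observation `Y_{i,j} = μ(x_j) + Z_i(x_j) + ε_{i,j}`. -/
def observation {d n : ℕ} {p : Fin d → ℕ} {Ω : Type*} (x : (k : Fin d) → Fin (p k) → ℝ)
    (μ : (Fin d → ℝ) → ℝ) (Z : Fin n → Ω → (Fin d → ℝ) → ℝ) (ε : Fin n → GridIndex p → Ω → ℝ)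
    (i : Fin n) (j : GridIndex p) (ω : Ω) : ℝ :=
  μ (gridPoint x j) + Z i ω (gridPoint x j) + ε i j ω

/-- The linear estimator at `y`: the weighted sum of the averages `(1/n) ∑ i, Y i j ω`. -/
def linearEstimator {d n : ℕ} {p : Fin d → ℕ} {Ω : Type*}
    (w : ℝ → (Fin d → ℝ) → GridIndex p → ℝ) (Y : Fin n → GridIndex p → Ω → ℝ)
    (h : ℝ) (y : Fin d → ℝ) (ω : Ω) : ℝ :=
  ∑ j, w h y j * (1 / (n : ℝ) * ∑ i, Y i j ω)

/-- The sup-norm on `[0,1]^d`, with values in `[0,∞]`. -/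
def cubeSupNorm {d : ℕ} (f : (Fin d → ℝ) → ℝ) : ℝ≥0∞ :=
  ⨆ x ∈ unitCube d, ENNReal.ofReal |f x|

/-- The rate `a_{n,p,h}`, with `κ = min(|s|, β₁)`. -/
def upperRate {d : ℕ} (s : Fin d → ℕ) (α L ζ σ CZ β₁ : ℝ) (n : ℕ) (p : Fin d → ℕ) (h : ℝ) : ℝ :=
  max (max (L * h ^ (α - (multiLength s : ℝ)))
      (ζ * σ * √(Real.log h⁻¹ / (n * gridSize p * h ^ (d + 2 * multiLength s)))))
    (CZ / (√n * h ^ ((multiLength s : ℝ) - min (multiLength s : ℝ) β₁)))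

end

/-! The estimation error splits into a bias, an averaged process and an averaged noise term. In each
of them a window of radius `h` contains O(h^d N) design points, where N is the size of the grid, and
the weights are O(1 / (N h^(d+|s|))). Hence a function of size h^e on the window contributes
O(h^(e-|s|)).

Bias. The moment conditions turn the Taylor polynomial of μ at y into ∂^s μ(y)
(`sum_mul_cubeTaylor`), so only the Taylor remainder, of order L h^α, is left
(`WeightConditions.abs_sum_mul_sub_le`).

Process. The map f ↦ ∑ w_j f(x_j) sends β-Hölder functions to bounded θ-Hölder functions for some θ
> 0, at the cost of a factor h^(κ-|s|) (`exists_holder_bound_sum_mul`). It remains to bound the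
supremum of a sum of independent centered Hölder processes by the root of the summed second moments
of their Hölder constants (`exists_lintegral_cubeSupNorm_sum_le`). Since only second moments are
available, the chaining argument uses at each dyadic level that ℓ^(2m) is 2-smooth with a
dimension-free constant (`PiLp.norm_add_sq_add_norm_sub_sq_le`) and therefore of type 2
(`integral_norm_sum_sq_le`). The number of nodes then enters only through its power 1/(2m), and for
large m the decay 2^(-kθ) of the increments wins.

Noise. A sub-Gaussian maximal inequality on a grid of mesh N^(-2), with Lipschitz weights between
the nodes, gives the desired rate with log N in place of log h⁻¹ (`exists_lintegral_error_le`). If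
log N exceeds a fixed multiple of log h⁻¹, then `h` is so large that the noise is at most a constant
times the bias rate; otherwise the logarithms may be exchanged (`error_rate_le`). -/

open scoped NNReal

/-! ### Symmetry of iterated derivatives within a set, and Taylor's formula -/

section IteratedDerivative

variable {E : Type*} [NormedAddCommGroup E] [NormedSpace ℝ E] {S : Set E} {f : E → ℝ}

theorem fderivWithin_iteratedFDerivWithin_apply {n : ℕ} (hS : UniqueDiffOn ℝ S)
    (hf : ContDiffOn ℝ (n + 1 : ℕ) f S) {x : E} (hx : x ∈ S) (m : Fin n → E) (a : E) :
    fderivWithin ℝ (iteratedFDerivWithin ℝ n f S) S x a m =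
      fderivWithin ℝ (fun y => iteratedFDerivWithin ℝ n f S y m) S x a := by
  have hd : DifferentiableWithinAt ℝ (iteratedFDerivWithin ℝ n f S) S x :=
    hf.differentiableOn_iteratedFDerivWithin (by exact_mod_cast n.lt_succ_self) hS x hx
  have h := ((ContinuousMultilinearMap.apply ℝ (fun _ : Fin n => E) ℝ m).hasFDerivAt
    (x := iteratedFDerivWithin ℝ n f S x)).comp_hasFDerivWithinAt x hd.hasFDerivWithinAt
  have h2 := h.fderivWithin (hS x hx)
  have h3 : fderivWithin ℝ (fun y => iteratedFDerivWithin ℝ n f S y m) S x a =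
    ((ContinuousMultilinearMap.apply ℝ (fun _ : Fin n => E) ℝ m).comp
      (fderivWithin ℝ (iteratedFDerivWithin ℝ n f S) S x)) a := by
    rw [← h2]; rfl
  rw [h3]; rfl

/-- Swapping the first two arguments is the symmetry of the second derivative of the iterated
derivative two orders lower. A swap further to the right leaves the first argument alone and is
obtained by differentiating the same identity one order lower. Adjacent transpositions generate all
permutations. -/
theorem iteratedFDerivWithin_comp_swap (hS : UniqueDiffOn ℝ S) (hS' : S ⊆ closure (interior S))
    (n : ℕ) (hf : ContDiffOn ℝ (n + 1 : ℕ) f S) {x : E} (hx : x ∈ S) (i : Fin n)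
    (v : Fin (n + 1) → E) :
    iteratedFDerivWithin ℝ (n + 1) f S x (v ∘ Equiv.swap i.castSucc i.succ) =
      iteratedFDerivWithin ℝ (n + 1) f S x v := by
  induction n generalizing x with
  | zero => exact i.elim0
  | succ n ih =>
    have hf' : ContDiffOn ℝ (n + 1 : ℕ) f S := hf.of_le (by exact_mod_cast (n + 1).le_succ)
    refine Fin.cases ?_ (fun j => ?_) i
    · have key : ∀ u : Fin (n + 1 + 1) → E, iteratedFDerivWithin ℝ (n + 1 + 1) f S x u =
          fderivWithin ℝ (fderivWithin ℝ (iteratedFDerivWithin ℝ n f S) S) S x (u 0) (u 1)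
            (Fin.tail (Fin.tail u)) := by
        intro u
        rw [iteratedFDerivWithin_succ_apply_left, fderivWithin_iteratedFDerivWithin_apply hS hf hx]
        have hd : DifferentiableWithinAt ℝ (fderivWithin ℝ (iteratedFDerivWithin ℝ n f S) S) S x := by
          have h1 : ContDiffOn ℝ (1 + 1) (iteratedFDerivWithin ℝ n f S) S :=
            fun y hy => (hf y hy).iteratedFDerivWithin_right hS (by norm_cast; omega) hy
          have h2 : ContDiffOn ℝ 1 (fderivWithin ℝ (iteratedFDerivWithin ℝ n f S) S) S :=
            h1.fderivWithin hS le_rfl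
          exact (h2.differentiableOn one_ne_zero) x hx
        have h0 := hd.hasFDerivWithinAt.clm_apply (hasFDerivWithinAt_const (u 1) x S)
        have h := ((ContinuousMultilinearMap.apply ℝ (fun _ : Fin n => E) ℝ
          (Fin.tail (Fin.tail u))).hasFDerivAt
          (x := fderivWithin ℝ (iteratedFDerivWithin ℝ n f S) S x (u 1))).comp_hasFDerivWithinAt x
            h0
        have h2 := h.fderivWithin (hS x hx)
        have h3 := congrArg (fun L : E →L[ℝ] ℝ => L (u 0)) h2
        refine Eq.trans ?_ (h3.trans ?_)
        swap
        · simp [ContinuousMultilinearMap.apply_apply]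
        refine congrArg (fun L : E →L[ℝ] ℝ => L (u 0)) (fderivWithin_congr (fun y hy => ?_) ?_)
        · rw [iteratedFDerivWithin_succ_apply_left]; rfl
        · rw [iteratedFDerivWithin_succ_apply_left]; rfl
      rw [key, key]
      have hsymm : IsSymmSndFDerivWithinAt ℝ (iteratedFDerivWithin ℝ n f S) S x := by
        have h1 : ContDiffOn ℝ 2 (iteratedFDerivWithin ℝ n f S) S :=
            fun y hy => (hf y hy).iteratedFDerivWithin_right hS (by norm_cast; omega) hy
        exact (h1 x hx).isSymmSndFDerivWithinAt (by simp) hS (hS' hx) hx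
      have h0 : (v ∘ Equiv.swap (Fin.castSucc (0 : Fin (n + 1))) (Fin.succ 0)) 0 = v 1 := by
        simp
      have h1 : (v ∘ Equiv.swap (Fin.castSucc (0 : Fin (n + 1))) (Fin.succ 0)) 1 = v 0 := by
        simp
      have h2 : Fin.tail (Fin.tail (v ∘ Equiv.swap (Fin.castSucc (0 : Fin (n + 1))) (Fin.succ 0)))
          = Fin.tail (Fin.tail v) := by
        funext l
        simp only [Fin.tail, Function.comp]
        rw [Equiv.swap_apply_of_ne_of_ne]
        · simp [Fin.ext_iff]
        · simp [Fin.ext_iff]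
      rw [h0, h1, h2, hsymm.eq]
    · rw [iteratedFDerivWithin_succ_apply_left, iteratedFDerivWithin_succ_apply_left,
        fderivWithin_iteratedFDerivWithin_apply hS hf hx,
        fderivWithin_iteratedFDerivWithin_apply hS hf hx]
      have h0 : (v ∘ Equiv.swap j.succ.castSucc j.succ.succ) 0 = v 0 := by
        simp only [Function.comp]
        rw [Equiv.swap_apply_of_ne_of_ne] <;> simp [Fin.ext_iff]
      have h1 : Fin.tail (v ∘ Equiv.swap j.succ.castSucc j.succ.succ) =
          Fin.tail v ∘ Equiv.swap j.castSucc j.succ := by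
        funext l
        simp only [Fin.tail, Function.comp]
        rw [← Fin.succ_castSucc]
        congr 1
        exact ((Fin.succ_injective _).map_swap _ _ _).symm
      rw [h0, h1]
      have hc : Set.EqOn (fun y => iteratedFDerivWithin ℝ (n + 1) f S y
          (Fin.tail v ∘ Equiv.swap j.castSucc j.succ))
          (fun y => iteratedFDerivWithin ℝ (n + 1) f S y (Fin.tail v)) S :=
        fun y hy => ih hf' hy j _
      rw [fderivWithin_congr hc (hc hx)]

/-- The iterated derivative of order `n` of a function of class `C^n` is symmetric. -/
theorem ContDiffOn.iteratedFDerivWithin_comp_perm_real (hS : UniqueDiffOn ℝ S)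
    (hS' : S ⊆ closure (interior S)) {n : ℕ} (hf : ContDiffOn ℝ n f S) {x : E} (hx : x ∈ S)
    (v : Fin n → E) (π : Equiv.Perm (Fin n)) :
    iteratedFDerivWithin ℝ n f S x (v ∘ π) = iteratedFDerivWithin ℝ n f S x v := by
  cases n with
  | zero => congr 1; exact Subsingleton.elim _ _
  | succ n =>
    have hπ : π ∈ Submonoid.closure
        (Set.range fun i : Fin n => Equiv.swap i.castSucc i.succ) := by
      rw [Equiv.Perm.mclosure_swap_castSucc_succ]; trivial
    induction hπ using Submonoid.closure_induction generalizing v with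
    | mem π h =>
      obtain ⟨i, rfl⟩ := h
      exact iteratedFDerivWithin_comp_swap hS hS' n hf hx i v
    | one => rfl
    | mul π τ _ _ h1 h2 =>
      rw [Equiv.Perm.coe_mul, ← Function.comp_assoc, h2, h1]

/-- The segment is affine in `t`, so each differentiation only inserts one more copy of `v`. -/
theorem iteratedDerivWithin_comp_segment (hS : UniqueDiffOn ℝ S) (hc : Convex ℝ S) {n : ℕ}
    (hf : ContDiffOn ℝ n f S) {y v : E} (hy : y ∈ S) (hv : y + v ∈ S) {k : ℕ} (hk : k ≤ n)
    {t : ℝ} (ht : t ∈ Set.Icc (0 : ℝ) 1) :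
    iteratedDerivWithin k (fun t : ℝ => f (y + t • v)) (Set.Icc 0 1) t =
      iteratedFDerivWithin ℝ k f S (y + t • v) (fun _ => v) := by
  have hmem : ∀ t ∈ Set.Icc (0 : ℝ) 1, y + t • v ∈ S := fun t ht => hc.add_smul_mem hy hv ht
  induction k generalizing t with
  | zero => simp
  | succ k ih =>
    have hu := uniqueDiffOn_Icc (zero_lt_one (α := ℝ))
    rw [iteratedDerivWithin_succ, iteratedFDerivWithin_succ_apply_left,
      derivWithin_congr (fun u hu => ih (by omega) hu) (ih (by omega) ht)]
    have hd : DifferentiableWithinAt ℝ (iteratedFDerivWithin ℝ k f S) S (y + t • v) :=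
      hf.differentiableOn_iteratedFDerivWithin (by exact_mod_cast hk) hS _ (hmem t ht)
    have hl : HasDerivWithinAt (fun t : ℝ => y + t • v) v (Set.Icc 0 1) t := by
      have := ((hasDerivAt_id t).smul_const v).const_add y
      simpa using this.hasDerivWithinAt
    have h := ((ContinuousMultilinearMap.apply ℝ (fun _ : Fin k => E) ℝ (fun _ => v)).hasFDerivAt
      (x := iteratedFDerivWithin ℝ k f S (y + t • v))).comp_hasFDerivWithinAt (y + t • v)
        hd.hasFDerivWithinAt
    have h2 := h.comp_hasDerivWithinAt t hl hmem
    exact h2.derivWithin (hu t ht)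

/-- Taylor's formula with Lagrange remainder, on a convex set. -/
theorem exists_taylor_eq (hS : UniqueDiffOn ℝ S) (hc : Convex ℝ S) {n : ℕ}
    (hf : ContDiffOn ℝ n f S) {y x : E} (hy : y ∈ S) (hx : x ∈ S) :
    ∃ z ∈ S, ‖z - y‖ ≤ ‖x - y‖ ∧
      f x - ∑ k ∈ Finset.range (n + 1), (k ! : ℝ)⁻¹ *
          iteratedFDerivWithin ℝ k f S y (fun _ => x - y) =
        (n ! : ℝ)⁻¹ * (iteratedFDerivWithin ℝ n f S z (fun _ => x - y) -
          iteratedFDerivWithin ℝ n f S y (fun _ => x - y)) := by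
  cases n with
  | zero => exact ⟨x, hx, le_rfl, by simp⟩
  | succ n =>
    have hv : y + (x - y) ∈ S := by simpa using hx
    set g : ℝ → ℝ := fun t => f (y + t • (x - y)) with hg
    have hmem : ∀ t ∈ Set.Icc (0 : ℝ) 1, y + t • (x - y) ∈ S :=
      fun t ht => hc.add_smul_mem hy hv ht
    have hI : Set.uIcc (0 : ℝ) 1 = Set.Icc 0 1 := Set.uIcc_of_le zero_le_one
    have hgc : ContDiffOn ℝ (n + 1 : ℕ) g (Set.uIcc 0 1) := by
      rw [hI]
      exact hf.comp (by fun_prop) hmem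
    have hu := uniqueDiffOn_Icc (zero_lt_one (α := ℝ))
    -- The expansion stops one degree below the smoothness. Subtracting the top-degree term at `y`
    -- turns the Lagrange remainder into a difference of derivatives, to which a Hölder condition
    -- applies.
    obtain ⟨t, ht, h⟩ := taylor_mean_remainder_lagrange (n := n) (zero_ne_one (α := ℝ))
      (hgc.of_le (by exact_mod_cast n.le_succ))
      ((hgc.differentiableOn_iteratedDerivWithin (by exact_mod_cast n.lt_succ_self)
        (by rw [hI]; exact hu)).mono (by
          rw [Set.uIoo_of_le zero_le_one, hI]; exact Set.Ioo_subset_Icc_self))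
    have ht' : t ∈ Set.Icc (0 : ℝ) 1 := by
      rw [Set.uIoo_of_le zero_le_one] at ht; exact Set.Ioo_subset_Icc_self ht
    refine ⟨_, hmem t ht', ?_, ?_⟩
    · rw [add_sub_cancel_left, norm_smul, Real.norm_of_nonneg ht'.1]
      exact mul_le_of_le_one_left (norm_nonneg _) ht'.2
    · rw [hI, taylor_within_apply, iteratedDerivWithin_comp_segment hS hc hf hy hv le_rfl ht'] at h
      rw [Finset.sum_range_succ]
      have h1 : g 1 = f x := by simp [hg]
      have h2 : ∀ k ∈ Finset.range (n + 1), ((k ! : ℝ)⁻¹ * (1 - 0) ^ k) •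
          iteratedDerivWithin k g (Set.Icc 0 1) 0 =
          (k ! : ℝ)⁻¹ * iteratedFDerivWithin ℝ k f S y (fun _ => x - y) := by
        intro k hk
        rw [iteratedDerivWithin_comp_segment hS hc hf hy hv
          (by have := Finset.mem_range.1 hk; omega) (by simp)]
        simp
      rw [Finset.sum_congr rfl h2, h1] at h
      rw [← sub_sub, h]
      simp only [sub_zero, one_pow, mul_one]
      ring

end IteratedDerivative

/-! ### The cube as a domain of differentiation -/

section Cube

variable {d : ℕ}

theorem convex_unitCube : Convex ℝ (unitCube d) := convex_Icc 0 1

theorem interior_unitCube_nonempty : (interior (unitCube d)).Nonempty := by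
  rw [unitCube, ← Set.pi_univ_Icc, interior_pi_set Set.finite_univ]
  refine ⟨fun _ => 1 / 2, fun i _ => ?_⟩
  simp only [Pi.zero_apply, Pi.one_apply, interior_Icc, Set.mem_Ioo]
  norm_num

theorem uniqueDiffOn_unitCube : UniqueDiffOn ℝ (unitCube d) :=
  uniqueDiffOn_convex convex_unitCube interior_unitCube_nonempty

theorem unitCube_subset_closure_interior : unitCube d ⊆ closure (interior (unitCube d)) := by
  rw [convex_unitCube.closure_interior_eq_closure_of_nonempty_interior interior_unitCube_nonempty]
  exact subset_closure

end Cube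

/-! ### Multi-indices as classes of coordinate listings -/

section MultiIndex

variable {d : ℕ}

/-- The multi-index that counts how often each coordinate occurs in `σ`. -/
def multiCount {k : ℕ} (σ : Fin k → Fin d) : Fin d → ℕ :=
  fun i => (Finset.univ.filter fun l => σ l = i).card

theorem multiLength_multiCount {k : ℕ} (σ : Fin k → Fin d) : multiLength (multiCount σ) = k := by
  have := Finset.card_eq_sum_card_fiberwise (f := σ) (s := Finset.univ) (t := Finset.univ)
    (fun _ _ => Finset.mem_coe.2 (Finset.mem_univ _))
  simpa [multiLength, multiCount] using this.symm

theorem prod_comp_eq_prod_pow {k : ℕ} (σ : Fin k → Fin d) (T : Finset (Fin k)) (u : Fin d → ℝ) :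
    ∏ l ∈ T, u (σ l) = ∏ i, u i ^ (T.filter fun l => σ l = i).card := by
  rw [← Finset.prod_fiberwise T σ]
  refine Finset.prod_congr rfl fun i _ => ?_
  rw [← Finset.prod_const]
  refine Finset.prod_congr rfl fun l hl => ?_
  rw [(Finset.mem_filter.1 hl).2]

/-- Corresponding fibres have the same cardinality, so bijections between them glue to a
permutation. -/
theorem exists_perm_of_multiCount_eq {k : ℕ} {σ τ : Fin k → Fin d}
    (h : multiCount σ = multiCount τ) : ∃ π : Equiv.Perm (Fin k), τ ∘ π = σ := by
  have e : ∀ i, Nonempty ({l // σ l = i} ≃ {l // τ l = i}) := fun i => by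
    refine Fintype.card_eq.1 ?_
    rw [Fintype.card_subtype, Fintype.card_subtype]
    exact congrFun h i
  refine ⟨Equiv.ofFiberEquiv fun i => (e i).some, ?_⟩
  funext l
  exact Equiv.ofFiberEquiv_map _ l

/-- The listing of the coordinates, in increasing order, with multiplicities `s`. -/
def multiListing (s : Fin d → ℕ) : Fin (multiLength s) → Fin d := fun l =>
  (finSigmaFinEquiv.symm l).1

theorem multiCount_multiListing (s : Fin d → ℕ) : multiCount (multiListing s) = s := by
  funext i
  rw [multiCount, ← Fintype.card_subtype]
  have e : {l : Fin (multiLength s) // multiListing s l = i} ≃ Fin (s i) :=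
    ((finSigmaFinEquiv (n := s)).symm.subtypeEquiv (fun l => Iff.rfl)).trans
      (Equiv.sigmaSubtype (β := fun i => Fin (s i)) i)
  simpa using Fintype.card_congr e

/-- Orbit counting: the permutations act transitively on the listings with multiplicities `s`, and
the stabilizer of one listing has ∏ (s i)! elements. -/
theorem card_multiCount_eq (s : Fin d → ℕ) :
    (Finset.univ.filter fun σ : Fin (multiLength s) → Fin d => multiCount σ = s).card *
      ∏ i, (s i)! = (multiLength s)! := by
  have h1 : (multiLength s)! = Fintype.card (Equiv.Perm (Fin (multiLength s))) := by
    rw [Fintype.card_perm, Fintype.card_fin]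
  have hcomp : ∀ {k : ℕ} (σ : Fin k → Fin d) (π : Equiv.Perm (Fin k)),
      multiCount (σ ∘ π) = multiCount σ := by
    intro k σ π
    funext i
    simp only [multiCount, ← Fintype.card_subtype]
    exact Fintype.card_congr (π.subtypeEquiv fun _ => Iff.rfl)
  have h2 := Finset.card_eq_sum_card_fiberwise
    (f := fun π : Equiv.Perm (Fin (multiLength s)) => multiListing s ∘ π) (s := Finset.univ)
    (t := Finset.univ.filter fun σ : Fin (multiLength s) → Fin d => multiCount σ = s)
    (fun π _ => by
      simp only [Finset.coe_filter, Finset.mem_univ, true_and, Set.mem_ofPred_eq]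
      rw [hcomp, multiCount_multiListing])
  rw [h1, ← Finset.card_univ, h2, Finset.sum_const_nat]
  intro σ hσ
  obtain ⟨π, hπ⟩ := exists_perm_of_multiCount_eq
    (((Finset.mem_filter.1 hσ).2).trans (multiCount_multiListing s).symm)
  subst hπ
  rw [← Fintype.card_subtype]
  have h3 := DomMulAct.stabilizer_card (multiListing s)
  have h4 : ∀ i, Fintype.card {a // multiListing s a = i} = s i := fun i => by
    rw [Fintype.card_subtype]
    exact congrFun (multiCount_multiListing s) i
  simp only [h4] at h3
  rw [← h3]
  -- Right multiplication by π⁻¹ carries the fibre over the listing permuted by π to the stabilizer.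
  refine Fintype.card_congr ((Equiv.mulRight π⁻¹).subtypeEquiv fun g => ?_)
  rw [Equiv.coe_mulRight, Equiv.Perm.coe_mul, ← Function.comp_assoc]
  exact (Equiv.comp_symm_eq π _ _).symm

end MultiIndex

/-! ### Taylor polynomials on the cube and moment conditions -/

section Taylor

variable {d : ℕ} {f : (Fin d → ℝ) → ℝ}

theorem iteratedFDerivWithin_single_eq_partialDeriv {k : ℕ} (hf : ContDiffOn ℝ k f (unitCube d))
    {z : Fin d → ℝ} (hz : z ∈ unitCube d) (σ : Fin k → Fin d) :
    iteratedFDerivWithin ℝ k f (unitCube d) z (fun l => Pi.single (σ l) 1) =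
      partialDeriv (multiCount σ) f z := by
  -- A free multi-index `r` allows `k` to be replaced by `multiLength r`, so that both derivatives
  -- have the same order definitionally.
  have key : ∀ r : Fin d → ℕ, multiCount σ = r →
      iteratedFDerivWithin ℝ k f (unitCube d) z (fun l => Pi.single (σ l) 1) =
        partialDeriv r f z := by
    intro r hr
    have hk : k = multiLength r := by rw [← hr, multiLength_multiCount]
    subst hk
    obtain ⟨π, hπ⟩ := exists_perm_of_multiCount_eq (hr.trans (multiCount_multiListing r).symm)
    rw [← hπ]
    exact hf.iteratedFDerivWithin_comp_perm_real uniqueDiffOn_unitCube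
      unitCube_subset_closure_interior hz (fun l => Pi.single (multiListing r l) 1) π
  exact key _ rfl

theorem iteratedFDerivWithin_apply_eq_sum {k : ℕ} (hf : ContDiffOn ℝ k f (unitCube d))
    {z : Fin d → ℝ} (hz : z ∈ unitCube d) (v : Fin d → ℝ) :
    iteratedFDerivWithin ℝ k f (unitCube d) z (fun _ => v) =
      ∑ σ : Fin k → Fin d, (∏ l, v (σ l)) * partialDeriv (multiCount σ) f z := by
  have hv : v = ∑ i, v i • (Pi.single i (1 : ℝ) : Fin d → ℝ) := by
    funext i
    simp [Finset.sum_apply, Pi.single_apply]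
  have h := MultilinearMap.map_sum
    (iteratedFDerivWithin ℝ k f (unitCube d) z).toMultilinearMap
    (fun (_ : Fin k) i => v i • (Pi.single i (1 : ℝ) : Fin d → ℝ))
  rw [← hv] at h
  refine h.trans (Finset.sum_congr rfl fun σ _ => ?_)
  rw [← iteratedFDerivWithin_single_eq_partialDeriv hf hz σ]
  exact MultilinearMap.map_smul_univ
    (iteratedFDerivWithin ℝ k f (unitCube d) z).toMultilinearMap (fun l => v (σ l)) _

/-- The Taylor polynomial of order `b` of `f` at `y`, evaluated at `x`. -/
noncomputable def cubeTaylor (b : ℕ) (f : (Fin d → ℝ) → ℝ) (y x : Fin d → ℝ) : ℝ :=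
  ∑ k ∈ Finset.range (b + 1), (k ! : ℝ)⁻¹ *
    iteratedFDerivWithin ℝ k f (unitCube d) y (fun _ => x - y)

/-- Expanded over coordinate listings, only those with multiplicities `s` survive. There are |s|!/s!
of them, each with moment s! and Taylor factor 1/|s|!, so the coefficient of ∂^s f is one. If |s| >
b, none occurs. -/
theorem sum_mul_cubeTaylor {ι : Type*} [Fintype ι] {b : ℕ} (hf : ContDiffOn ℝ b f (unitCube d))
    {y : Fin d → ℝ} (hy : y ∈ unitCube d) (w : ι → ℝ) (x : ι → Fin d → ℝ) (s : Fin d → ℕ)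
    (hw : ∀ k ≤ b, ∀ σ : Fin k → Fin d, ∑ j, w j * ∏ l, (x j - y) (σ l) =
      if multiCount σ = s then ((∏ i, (s i)! : ℕ) : ℝ) else 0) :
    ∑ j, w j * cubeTaylor b f y (x j) = if multiLength s ≤ b then partialDeriv s f y else 0 := by
  have h1 : ∑ j, w j * cubeTaylor b f y (x j) = ∑ k ∈ Finset.range (b + 1), (k ! : ℝ)⁻¹ *
      ∑ σ : Fin k → Fin d, (if multiCount σ = s then ((∏ i, (s i)! : ℕ) : ℝ) else 0) *
        partialDeriv (multiCount σ) f y := by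
    simp only [cubeTaylor, Finset.mul_sum]
    rw [Finset.sum_comm]
    refine Finset.sum_congr rfl fun k hk => ?_
    have hkb : k ≤ b := by have := Finset.mem_range.1 hk; omega
    have hfk : ContDiffOn ℝ k f (unitCube d) := hf.of_le (by exact_mod_cast hkb)
    simp only [iteratedFDerivWithin_apply_eq_sum hfk hy, ← hw k hkb, Finset.sum_mul,
      Finset.mul_sum]
    rw [Finset.sum_comm]
    refine Finset.sum_congr rfl fun σ _ => Finset.sum_congr rfl fun j _ => ?_
    ring
  have h2 : ∀ k, (k ! : ℝ)⁻¹ * ∑ σ : Fin k → Fin d,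
      (if multiCount σ = s then ((∏ i, (s i)! : ℕ) : ℝ) else 0) * partialDeriv (multiCount σ) f y =
      if k = multiLength s then partialDeriv s f y else 0 := by
    intro k
    split_ifs with hk
    · subst hk
      have h3 : ∀ σ : Fin (multiLength s) → Fin d,
          (if multiCount σ = s then ((∏ i, (s i)! : ℕ) : ℝ) else 0) *
            partialDeriv (multiCount σ) f y =
          if multiCount σ = s then ((∏ i, (s i)! : ℕ) : ℝ) * partialDeriv s f y else 0 := by
        intro σ
        split_ifs with h
        · rw [h]
        · simp
      simp only [h3]
      rw [← Finset.sum_filter, Finset.sum_const, nsmul_eq_mul, ← mul_assoc, ← mul_assoc,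
        mul_assoc _ _ ((∏ i, (s i)! : ℕ) : ℝ), ← Nat.cast_mul, card_multiCount_eq,
        inv_mul_cancel₀ (by positivity), one_mul]
    · rw [Finset.sum_eq_zero, mul_zero]
      intro σ _
      rw [if_neg, zero_mul]
      intro h
      exact hk (by rw [← h, multiLength_multiCount])
  rw [h1, Finset.sum_congr rfl fun k _ => h2 k]
  simp

theorem sum_mul_prod_eq {ι : Type*} [Fintype ι] {m : ℕ} {w : ι → ℝ} {x : ι → Fin d → ℝ}
    {s : Fin d → ℕ} {y : Fin d → ℝ}
    (hw : ∀ r : Fin d → ℕ, multiLength r ≤ m → ∑ j, (∏ k, (x j k - y k) ^ r k) * w j =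
      if r = s then ((∏ k, (s k)! : ℕ) : ℝ) else 0)
    {k : ℕ} (hk : k ≤ m) (σ : Fin k → Fin d) :
    ∑ j, w j * ∏ l, (x j - y) (σ l) =
      if multiCount σ = s then ((∏ i, (s i)! : ℕ) : ℝ) else 0 := by
  rw [← hw (multiCount σ) (by rwa [multiLength_multiCount])]
  refine Finset.sum_congr rfl fun j _ => ?_
  rw [mul_comm, prod_comp_eq_prod_pow]
  rfl

/-- The moments of degree at most |s| do not depend on the centre: writing x - z = (x - y) + (y -
z), every mixed term carries a moment about `y` of degree less than |s|, which vanishes. This lets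
the weights at two points be tested against one Taylor polynomial. -/
theorem sum_mul_prod_eq_of_le {ι : Type*} [Fintype ι] {m : ℕ} {w : ι → ℝ} {x : ι → Fin d → ℝ}
    {s : Fin d → ℕ} {y : Fin d → ℝ}
    (hw : ∀ r : Fin d → ℕ, multiLength r ≤ m → ∑ j, (∏ k, (x j k - y k) ^ r k) * w j =
      if r = s then ((∏ k, (s k)! : ℕ) : ℝ) else 0) (z : Fin d → ℝ)
    {k : ℕ} (hk : k ≤ m) (hks : k ≤ multiLength s) (σ : Fin k → Fin d) :
    ∑ j, w j * ∏ l, (x j - z) (σ l) =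
      if multiCount σ = s then ((∏ i, (s i)! : ℕ) : ℝ) else 0 := by
  rw [← sum_mul_prod_eq hw hk σ]
  have h1 : ∀ j, ∏ l, (x j - z) (σ l) = ∑ T ∈ (Finset.univ : Finset (Fin k)).powerset,
      (∏ l ∈ T, (x j - y) (σ l)) * ∏ l ∈ Finset.univ \ T, (y - z) (σ l) := by
    intro j
    rw [← Finset.prod_add]
    refine Finset.prod_congr rfl fun l _ => ?_
    simp
  simp only [h1, Finset.mul_sum]
  rw [Finset.sum_comm, Finset.sum_eq_single Finset.univ]
  · simp
  · intro T _ hT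
    have hcard : T.card < k := by
      have := Finset.card_lt_card (Finset.ssubset_univ_iff.2 hT)
      simpa using this
    set r : Fin d → ℕ := fun i => (T.filter fun l => σ l = i).card with hr
    have hlen : multiLength r = T.card :=
      (Finset.card_eq_sum_card_fiberwise (f := σ) (t := Finset.univ)
        (fun _ _ => Finset.mem_coe.2 (Finset.mem_univ _))).symm
    have h2 := hw r (by omega)
    have h3 : r ≠ s := by
      rintro rfl
      omega
    rw [if_neg h3] at h2
    have h4 : ∀ j, w j * ((∏ l ∈ T, (x j - y) (σ l)) * ∏ l ∈ Finset.univ \ T, (y - z) (σ l)) =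
        ((∏ i, (x j i - y i) ^ r i) * w j) * ∏ l ∈ Finset.univ \ T, (y - z) (σ l) := by
      intro j
      rw [prod_comp_eq_prod_pow σ T]
      simp only [Pi.sub_apply, hr]
      ring
    simp only [h4]
    rw [← Finset.sum_mul, h2, zero_mul]
  · simp

end Taylor

/-! ### Taylor remainder of Hölder functions -/

section Holder

variable {d : ℕ} {f : (Fin d → ℝ) → ℝ} {α M : ℝ}

theorem HolderClass.mono {M' : ℝ} (hf : HolderClass α M f) (h : M ≤ M') : HolderClass α M' f :=
  ⟨hf.1, hf.2.trans (ENNReal.ofReal_le_ofReal h)⟩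

theorem HolderClass.abs_partialDeriv_le (hf : HolderClass α M f) (hM : 0 ≤ M) {r : Fin d → ℕ}
    (hr : multiLength r ≤ strictFloor α) {x : Fin d → ℝ} (hx : x ∈ unitCube d) :
    |partialDeriv r f x| ≤ M := by
  refine (ENNReal.ofReal_le_ofReal_iff hM).1 (le_trans ?_ ((le_add_right le_rfl).trans hf.2))
  exact le_iSup₂_of_le r hr (le_iSup₂_of_le x hx le_rfl)

theorem HolderClass.abs_partialDeriv_sub_le (hf : HolderClass α M f) (hM : 0 ≤ M)
    {r : Fin d → ℕ} (hr : multiLength r = strictFloor α) {x y : Fin d → ℝ}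
    (hx : x ∈ unitCube d) (hy : y ∈ unitCube d) :
    |partialDeriv r f x - partialDeriv r f y| ≤ M * ‖x - y‖ ^ (α - strictFloor α) := by
  rcases eq_or_ne x y with rfl | hxy
  · rw [sub_self, abs_zero]; positivity
  have h : ENNReal.ofReal (|partialDeriv r f x - partialDeriv r f y| /
      ‖x - y‖ ^ (α - strictFloor α)) ≤ ENNReal.ofReal M := by
    refine le_trans ?_ ((le_add_left le_rfl).trans hf.2)
    exact le_iSup₂_of_le r hr (le_iSup₂_of_le x hx (le_iSup₂_of_le y hy (le_iSup_of_le hxy le_rfl)))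
  have h2 := (ENNReal.ofReal_le_ofReal_iff hM).1 h
  have h3 : 0 < ‖x - y‖ := norm_pos_iff.2 (sub_ne_zero.2 hxy)
  rwa [div_le_iff₀ (Real.rpow_pos_of_pos h3 _)] at h2

theorem strictFloor_lt (hα : 0 < α) : (strictFloor α : ℝ) < α :=
  (le_strictFloor_iff hα _).1 le_rfl

theorem le_strictFloor_add_one : α ≤ strictFloor α + 1 := by
  have h : (⌈α⌉₊ : ℝ) ≤ (strictFloor α : ℝ) + 1 := by
    have : ⌈α⌉₊ ≤ strictFloor α + 1 := by rw [strictFloor]; omega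
    exact_mod_cast this
  exact (Nat.le_ceil α).trans h

/-- Partial derivatives of less than the maximal order are Lipschitz continuous. -/
theorem HolderClass.abs_partialDeriv_sub_le_of_lt (hf : HolderClass α M f) (hM : 0 ≤ M)
    {b : ℕ} (hb : b < strictFloor α) (σ : Fin b → Fin d) {x y : Fin d → ℝ}
    (hx : x ∈ unitCube d) (hy : y ∈ unitCube d) :
    |partialDeriv (multiCount σ) f x - partialDeriv (multiCount σ) f y| ≤ d * M * ‖x - y‖ := by
  have hfb : ContDiffOn ℝ (b + 1 : ℕ) f (unitCube d) := hf.1.of_le (by exact_mod_cast hb)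
  have hfb' : ContDiffOn ℝ b f (unitCube d) := hf.1.of_le (by exact_mod_cast hb.le)
  set g : (Fin d → ℝ) → ℝ := fun z =>
    iteratedFDerivWithin ℝ b f (unitCube d) z (fun l => Pi.single (σ l) 1) with hg
  have hgd : ∀ z ∈ unitCube d, HasFDerivWithinAt g (fderivWithin ℝ g (unitCube d) z)
      (unitCube d) z := by
    intro z hz
    have hd : DifferentiableWithinAt ℝ (iteratedFDerivWithin ℝ b f (unitCube d)) (unitCube d) z :=
      hfb.differentiableOn_iteratedFDerivWithin (by exact_mod_cast b.lt_succ_self)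
        uniqueDiffOn_unitCube z hz
    exact ((ContinuousMultilinearMap.apply ℝ (fun _ : Fin b => (Fin d → ℝ)) ℝ
      (fun l => Pi.single (σ l) 1)).differentiableAt.comp_differentiableWithinAt z
        hd).hasFDerivWithinAt
  -- The norm dual to the maximum norm is the ℓ¹-norm; summing the `d` partial derivatives of the
  -- next order, each at most `M`, gives the factor `d`.
  have hbound : ∀ z ∈ unitCube d, ‖fderivWithin ℝ g (unitCube d) z‖ ≤ d * M := by
    intro z hz
    refine ContinuousLinearMap.opNorm_le_bound _ (by positivity) fun v => ?_
    have hv : v = ∑ i, v i • (Pi.single i (1 : ℝ) : Fin d → ℝ) := by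
      funext i
      simp [Finset.sum_apply, Pi.single_apply]
    have hL : ∀ i, |fderivWithin ℝ g (unitCube d) z (Pi.single i 1)| ≤ M := by
      intro i
      have h1 : fderivWithin ℝ g (unitCube d) z (Pi.single i 1) =
          partialDeriv (multiCount (Fin.cons i σ : Fin (b + 1) → Fin d)) f z := by
        rw [← iteratedFDerivWithin_single_eq_partialDeriv hfb hz,
          iteratedFDerivWithin_succ_apply_left,
          fderivWithin_iteratedFDerivWithin_apply uniqueDiffOn_unitCube hfb hz]
        rfl
      rw [h1]
      exact hf.abs_partialDeriv_le hM (by rw [multiLength_multiCount]; omega) hz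
    conv_lhs => rw [hv]
    rw [map_sum]
    refine (norm_sum_le _ _).trans ?_
    have h2 : ∀ i ∈ Finset.univ, ‖fderivWithin ℝ g (unitCube d) z (v i • Pi.single i 1)‖ ≤
        M * ‖v‖ := by
      intro i _
      rw [map_smul, norm_smul, mul_comm]
      exact mul_le_mul (hL i) (norm_le_pi_norm v i) (norm_nonneg _) hM
    refine (Finset.sum_le_sum h2).trans ?_
    simp [mul_assoc]
  have h := convex_unitCube.norm_image_sub_le_of_norm_hasFDerivWithin_le hgd hbound hy hx
  rw [← iteratedFDerivWithin_single_eq_partialDeriv hfb' hx,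
    ← iteratedFDerivWithin_single_eq_partialDeriv hfb' hy]
  exact h

theorem HolderClass.abs_partialDeriv_sub_le_min (hα : 0 < α) (hd : 0 < d) (hf : HolderClass α M f)
    (hM : 0 ≤ M) {b : ℕ} (hb : b ≤ strictFloor α) (σ : Fin b → Fin d) {x y : Fin d → ℝ}
    (hx : x ∈ unitCube d) (hy : y ∈ unitCube d) :
    |partialDeriv (multiCount σ) f x - partialDeriv (multiCount σ) f y| ≤
      d * M * ‖x - y‖ ^ min 1 (α - b) := by
  have hd' : (1 : ℝ) ≤ d := by exact_mod_cast hd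
  rcases hb.lt_or_eq with h | h
  · have h1 : (b : ℝ) + 1 ≤ strictFloor α := by exact_mod_cast h
    rw [min_eq_left (by linarith [strictFloor_lt hα]), Real.rpow_one]
    exact hf.abs_partialDeriv_sub_le_of_lt hM h σ hx hy
  · have h1 := le_strictFloor_add_one (α := α)
    subst h
    rw [min_eq_right (by linarith)]
    refine (hf.abs_partialDeriv_sub_le hM (by rw [multiLength_multiCount]) hx hy).trans ?_
    exact mul_le_mul_of_nonneg_right (by nlinarith) (by positivity)

/-- The expansion may stop at any order `b ≤ ⌊α⌋`: the weights have only finitely many moments,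
which need not reach the smoothness of the process. The constant counts the `d ^ b` coordinate
listings, each with Hölder constant `d * M`. -/
theorem HolderClass.abs_sub_cubeTaylor_le (hα : 0 < α) (hd : 0 < d) (hf : HolderClass α M f)
    (hM : 0 ≤ M) {b : ℕ} (hb : b ≤ strictFloor α) {x y : Fin d → ℝ}
    (hx : x ∈ unitCube d) (hy : y ∈ unitCube d) :
    |f x - cubeTaylor b f y x| ≤ d ^ (b + 1) * M * ‖x - y‖ ^ (b + min 1 (α - b)) := by
  have hfb : ContDiffOn ℝ b f (unitCube d) := hf.1.of_le (by exact_mod_cast hb)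
  have hγ : 0 ≤ min 1 (α - b) := by
    have := (le_strictFloor_iff hα b).1 hb
    exact le_min zero_le_one (by linarith)
  obtain ⟨z, hz, hzy, h⟩ := exists_taylor_eq uniqueDiffOn_unitCube convex_unitCube hfb hy hx
  rw [cubeTaylor, h, iteratedFDerivWithin_apply_eq_sum hfb hz,
    iteratedFDerivWithin_apply_eq_sum hfb hy, ← Finset.sum_sub_distrib, abs_mul,
    abs_of_nonneg (by positivity)]
  have h1 : ∀ σ ∈ (Finset.univ : Finset (Fin b → Fin d)),
      |(∏ l, (x - y) (σ l)) * partialDeriv (multiCount σ) f z -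
        (∏ l, (x - y) (σ l)) * partialDeriv (multiCount σ) f y| ≤
      ‖x - y‖ ^ b * (d * M * ‖x - y‖ ^ min 1 (α - b)) := by
    intro σ _
    rw [← mul_sub, abs_mul, Finset.abs_prod]
    refine mul_le_mul ?_ ?_ (abs_nonneg _) (by positivity)
    · calc ∏ l, |(x - y) (σ l)| ≤ ∏ _l : Fin b, ‖x - y‖ :=
            Finset.prod_le_prod (fun _ _ => abs_nonneg _) fun l _ => norm_le_pi_norm (x - y) (σ l)
        _ = ‖x - y‖ ^ b := by simp
    · refine (hf.abs_partialDeriv_sub_le_min hα hd hM hb σ hz hy).trans ?_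
      gcongr
  have h2 : (b ! : ℝ)⁻¹ ≤ 1 := inv_le_one_of_one_le₀ (by exact_mod_cast Nat.factorial_pos b)
  refine (mul_le_of_le_one_left (abs_nonneg _) h2).trans
    ((Finset.abs_sum_le_sum_abs _ _).trans ((Finset.sum_le_sum h1).trans (le_of_eq ?_)))
  rw [Real.rpow_add_of_nonneg (norm_nonneg _) (by positivity) hγ, Real.rpow_natCast,
    Finset.sum_const, nsmul_eq_mul]
  simp only [Finset.card_univ, Fintype.card_pi, Fintype.card_fin, Finset.prod_const]
  push_cast
  ring

end Holder

/-! ### 2-smoothness of ℓ^(2m) -/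

section SmoothNorm

/-- The even and odd parts of (a + b)^n satisfy a linear recursion that mixes them, so the two
bounds are proved together. The factor `R` in the odd bound avoids a division by `R`. -/
theorem even_odd_part_le {a b R : ℝ} {N : ℕ} (ha : 0 ≤ a) (hb : 0 ≤ b) (hR : 0 ≤ R)
    (hRa : R ^ 2 = a ^ 2 + 2 * N * b ^ 2) (n : ℕ) (hn : n ≤ N) :
    (a + b) ^ n + (a - b) ^ n ≤ 2 * R ^ n ∧
      R * ((a + b) ^ n - (a - b) ^ n) ≤ 2 * (n * b * R ^ n) := by
  have haR : a ≤ R := by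
    refine abs_le_of_sq_le_sq' ?_ hR |>.2
    rw [hRa]; nlinarith [sq_nonneg b, (Nat.cast_nonneg N : (0 : ℝ) ≤ N)]
  induction n with
  | zero => simp; norm_num
  | succ n ih =>
    obtain ⟨h1, h2⟩ := ih (by omega)
    have hnN : (n : ℝ) ≤ N := by exact_mod_cast (by omega : n ≤ N)
    have e1 : (a + b) ^ (n + 1) + (a - b) ^ (n + 1) =
        a * ((a + b) ^ n + (a - b) ^ n) + b * ((a + b) ^ n - (a - b) ^ n) := by ring
    have e2 : (a + b) ^ (n + 1) - (a - b) ^ (n + 1) =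
        a * ((a + b) ^ n - (a - b) ^ n) + b * ((a + b) ^ n + (a - b) ^ n) := by ring
    have hRn : 0 ≤ R ^ n := by positivity
    constructor
    · rcases hR.eq_or_lt with h0 | hpos
      · have ha0 : a = 0 := by linarith
        have hb0 : b = 0 ∨ N = 0 := by
          rw [← h0, ha0] at hRa
          have : (N : ℝ) * b ^ 2 = 0 := by linarith
          rcases mul_eq_zero.1 this with h | h
          · right; exact_mod_cast h
          · left; exact pow_eq_zero_iff two_ne_zero |>.1 h
        rcases hb0 with hb0 | hN
        · rw [ha0, hb0, ← h0]; simp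
        · omega
      · refine le_of_mul_le_mul_left ?_ hpos
        -- R a ≤ (R² + a²)/2 = R² - N b², and n ≤ N.
        have h3 : R * a + n * b ^ 2 ≤ R ^ 2 := by
          nlinarith [sq_nonneg (R - a), sq_nonneg b, mul_le_mul_of_nonneg_right hnN (sq_nonneg b)]
        calc R * ((a + b) ^ (n + 1) + (a - b) ^ (n + 1))
            = (R * a) * ((a + b) ^ n + (a - b) ^ n) +
                b * (R * ((a + b) ^ n - (a - b) ^ n)) := by rw [e1]; ring
          _ ≤ (R * a) * (2 * R ^ n) + b * (2 * (n * b * R ^ n)) := by gcongr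
          _ = 2 * R ^ n * (R * a + n * b ^ 2) := by ring
          _ ≤ 2 * R ^ n * R ^ 2 := by gcongr
          _ = R * (2 * R ^ (n + 1)) := by ring
    · calc R * ((a + b) ^ (n + 1) - (a - b) ^ (n + 1))
          = a * (R * ((a + b) ^ n - (a - b) ^ n)) + R * b * ((a + b) ^ n + (a - b) ^ n) := by
            rw [e2]; ring
        _ ≤ R * (2 * (n * b * R ^ n)) + R * b * (2 * R ^ n) := by
            gcongr ?_ + R * b * ?_
            calc a * (R * ((a + b) ^ n - (a - b) ^ n)) ≤ a * (2 * (n * b * R ^ n)) := by gcongr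
              _ ≤ R * (2 * (n * b * R ^ n)) := by gcongr
        _ = 2 * ((n + 1 : ℕ) * b * R ^ (n + 1)) := by push_cast; ring

theorem add_pow_add_sub_pow_le (a b : ℝ) (m : ℕ) :
    (a + b) ^ (2 * m) + (a - b) ^ (2 * m) ≤ 2 * (a ^ 2 + 4 * m * b ^ 2) ^ m := by
  have h := (even_odd_part_le (N := 2 * m) (abs_nonneg a) (abs_nonneg b)
    (Real.sqrt_nonneg (a ^ 2 + 4 * m * b ^ 2))
    (by rw [Real.sq_sqrt (by positivity), sq_abs, sq_abs]; push_cast; ring) (2 * m) le_rfl).1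
  rw [pow_mul √_, Real.sq_sqrt (by positivity)] at h
  refine le_trans (le_of_eq ?_) h
  have h2 : ∀ u v : ℝ, |u| = |v| → u ^ (2 * m) = v ^ (2 * m) := fun u v huv => by
    rw [pow_mul, pow_mul, ← sq_abs u, huv, sq_abs]
  rcases abs_choice a with ha | ha <;> rcases abs_choice b with hb | hb <;> rw [ha, hb]
  · rw [add_comm, sub_neg_eq_add, ← sub_eq_add_neg]
  · rw [add_comm]
    congr 1
    · exact h2 _ _ (by rw [← abs_neg]; congr 1; ring)
    · exact h2 _ _ (by rw [← abs_neg]; congr 1; ring)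
  · congr 1
    · exact h2 _ _ (by rw [← abs_neg]; congr 1; ring)
    · exact h2 _ _ (by rw [← abs_neg]; congr 1; ring)

/-- The scalar two-point inequality is applied in each coordinate, and Minkowski's inequality in ℓ^m
to the sequences x_i² and 4m y_i² separates the two norms. Convexity of t ↦ t^m brings the left side
to this form. The constant 4m does not depend on the dimension. -/
theorem PiLp.norm_add_sq_add_norm_sub_sq_le {κ : Type*} [Fintype κ] {m : ℕ} (hm : 0 < m)
    {p : ℝ≥0∞} [Fact (1 ≤ p)] (hp : p = (2 * m : ℕ)) (x y : PiLp p (fun _ : κ => ℝ)) :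
    ‖x + y‖ ^ 2 + ‖x - y‖ ^ 2 ≤ 2 * ‖x‖ ^ 2 + 2 * (4 * m) * ‖y‖ ^ 2 := by
  have hm' : (m : ℝ) ≠ 0 := by exact_mod_cast hm.ne'
  have hpow : ∀ z : PiLp p (fun _ : κ => ℝ), (‖z‖ ^ 2) ^ m = ∑ i, (z i ^ 2) ^ m := by
    intro z
    rw [← pow_mul, PiLp.norm_eq_of_nat (2 * m) hp, one_div,
      Real.rpow_inv_natCast_pow (by positivity) (by omega)]
    refine Finset.sum_congr rfl fun i _ => ?_
    rw [← pow_mul, pow_mul, Real.norm_eq_abs, sq_abs, ← pow_mul]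
  have hsq : ∀ z : PiLp p (fun _ : κ => ℝ), (∑ i, (z i ^ 2) ^ (m : ℝ)) ^ (1 / (m : ℝ)) =
      ‖z‖ ^ 2 := by
    intro z
    simp only [Real.rpow_natCast]
    rw [← hpow, one_div, Real.pow_rpow_inv_natCast (by positivity) hm.ne']
  have hmink : ∑ i, (x i ^ 2 + 4 * m * y i ^ 2) ^ m ≤ (‖x‖ ^ 2 + 4 * m * ‖y‖ ^ 2) ^ m := by
    have h := Real.Lp_add_le_of_nonneg Finset.univ (f := fun i => x i ^ 2)
      (g := fun i => 4 * m * y i ^ 2) (p := m) (by exact_mod_cast hm)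
      (fun i _ => by positivity) (fun i _ => by positivity)
    have h2 : (∑ i, (4 * m * y i ^ 2) ^ (m : ℝ)) ^ (1 / (m : ℝ)) = 4 * m * ‖y‖ ^ 2 := by
      have h3 : ∀ i, (4 * m * y i ^ 2) ^ (m : ℝ) = (4 * m : ℝ) ^ (m : ℝ) * (y i ^ 2) ^ (m : ℝ) :=
        fun i => Real.mul_rpow (by positivity) (by positivity)
      simp only [h3]
      rw [← Finset.mul_sum, Real.mul_rpow (by positivity)
        (Finset.sum_nonneg fun i _ => by positivity), hsq, ← Real.rpow_mul (by positivity),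
        mul_one_div_cancel hm', Real.rpow_one]
    rw [hsq, h2] at h
    have h4 := pow_le_pow_left₀ (by positivity) h m
    rw [one_div, Real.rpow_inv_natCast_pow (Finset.sum_nonneg fun i _ => by positivity) hm.ne'] at h4
    simpa only [Real.rpow_natCast] using h4
  have h1 : ((‖x + y‖ ^ 2 + ‖x - y‖ ^ 2) / 2) ^ m ≤ (‖x‖ ^ 2 + 4 * m * ‖y‖ ^ 2) ^ m := by
    refine le_trans ?_ hmink
    have h2 := add_pow_le (sq_nonneg ‖x + y‖) (sq_nonneg ‖x - y‖) m
    rw [div_pow, div_le_iff₀ (by positivity)]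
    refine h2.trans ?_
    have h3 : (2 : ℝ) ^ m = 2 ^ (m - 1) * 2 := by
      rw [← pow_succ]; congr 1; omega
    rw [h3, mul_comm _ (2 ^ (m - 1) * 2 : ℝ), mul_assoc]
    gcongr
    rw [hpow, hpow, ← Finset.sum_add_distrib, Finset.mul_sum]
    refine Finset.sum_le_sum fun i _ => ?_
    have := add_pow_add_sub_pow_le (x i) (y i) m
    simp only [← pow_mul]
    exact this
  have h2 := (pow_le_pow_iff_left₀ (by positivity) (by positivity) hm.ne').1 h1
  linarith

end SmoothNorm

/-! ### Second moments of sums of independent centered vectors -/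

section TypeTwo

variable {Ω : Type*} [MeasurableSpace Ω] {P : Measure Ω} [IsProbabilityMeasure P]
  {E : Type*} [NormedAddCommGroup E] [NormedSpace ℝ E] [CompleteSpace E] [MeasurableSpace E]
  [BorelSpace E] [SecondCountableTopology E]

/-- Jensen's inequality in `X` for fixed `S`, since S is the conditional mean of S - X given S. -/
theorem integral_norm_sq_le_of_indepFun {S X : Ω → E} (hS : MemLp S 2 P) (hX : MemLp X 2 P)
    (hSX : IndepFun S X P) (h0 : ∫ ω, X ω ∂P = 0) :
    ∫ ω, ‖S ω‖ ^ 2 ∂P ≤ ∫ ω, ‖S ω - X ω‖ ^ 2 ∂P := by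
  have hSm := hS.1.aemeasurable
  have hXm := hX.1.aemeasurable
  have hprod := (indepFun_iff_map_prod_eq_prod_map_map hSm hXm).1 hSX
  have : IsProbabilityMeasure (P.map S) := Measure.isProbabilityMeasure_map hSm
  have : IsProbabilityMeasure (P.map X) := Measure.isProbabilityMeasure_map hXm
  have hint : Integrable (fun ω => ‖S ω - X ω‖ ^ 2) P := (hS.sub hX).integrable_norm_pow two_ne_zero
  have hcont : Continuous fun z : E × E => ‖z.1 - z.2‖ ^ 2 := by fun_prop
  have hint2 : Integrable (fun z : E × E => ‖z.1 - z.2‖ ^ 2) ((P.map S).prod (P.map X)) := by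
    rw [← hprod, integrable_map_measure hcont.aestronglyMeasurable (hSm.prodMk hXm)]
    exact hint
  have h1 : ∫ ω, ‖S ω - X ω‖ ^ 2 ∂P =
      ∫ s, ∫ x, ‖s - x‖ ^ 2 ∂(P.map X) ∂(P.map S) := by
    rw [← integral_prod _ hint2, ← hprod,
      integral_map (hSm.prodMk hXm) hcont.aestronglyMeasurable]
  have h2 : ∫ ω, ‖S ω‖ ^ 2 ∂P = ∫ s, ‖s‖ ^ 2 ∂(P.map S) := by
    rw [integral_map hSm (by fun_prop)]
  have hXi : Integrable (fun x : E => x) (P.map X) :=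
    (integrable_map_measure (by fun_prop) hXm).2 (hX.integrable one_le_two)
  have hX2 : MemLp (fun x : E => x) 2 (P.map X) := (memLp_map_measure_iff (by fun_prop) hXm).2 hX
  have hX0 : ∫ x, x ∂(P.map X) = 0 := by
    rw [integral_map hXm (by fun_prop), h0]
  rw [h1, h2]
  refine integral_mono ?_ hint2.integral_prod_left fun s => ?_
  · rw [integrable_map_measure (by fun_prop) hSm]
    exact hS.integrable_norm_pow two_ne_zero
  · have hconv : ConvexOn ℝ Set.univ (fun x : E => ‖x‖ ^ 2) :=
      convexOn_univ_norm.pow (fun _ _ => norm_nonneg _) 2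
    have h := hconv.map_integral_le (μ := P.map X) (f := fun x => s - x)
      (by fun_prop : Continuous fun x : E => ‖x‖ ^ 2).continuousOn isClosed_univ
      (Filter.Eventually.of_forall fun _ => Set.mem_univ _)
      ((integrable_const s).sub hXi)
      (((memLp_const s).sub hX2).integrable_norm_pow two_ne_zero)
    rw [integral_sub (integrable_const s) hXi, hX0] at h
    simpa using h

/-- Spaces whose norm is `2`-smooth are of type `2`. -/
theorem integral_norm_sum_sq_le {D : ℝ}
    (hE : ∀ x y : E, ‖x + y‖ ^ 2 + ‖x - y‖ ^ 2 ≤ 2 * ‖x‖ ^ 2 + 2 * D * ‖y‖ ^ 2)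
    {ι : Type*} {X : ι → Ω → E} (hXm : ∀ i, Measurable (X i)) (hX : ∀ i, MemLp (X i) 2 P)
    (hind : iIndepFun X P) (h0 : ∀ i, ∫ ω, X i ω ∂P = 0) (T : Finset ι) :
    ∫ ω, ‖∑ i ∈ T, X i ω‖ ^ 2 ∂P ≤ 2 * D * ∑ i ∈ T, ∫ ω, ‖X i ω‖ ^ 2 ∂P := by
  classical
  induction T using Finset.induction_on with
  | empty => simp
  | insert i T hi ih =>
    have hS : MemLp (fun ω => ∑ i ∈ T, X i ω) 2 P := memLp_finsetSum T fun i _ => hX i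
    have hSX : IndepFun (fun ω => ∑ i ∈ T, X i ω) (X i) P := by
      have := hind.indepFun_finsetSum_of_notMem hXm hi
      convert this using 1
      funext ω
      simp
    have h1 := integral_norm_sq_le_of_indepFun hS (hX i) hSX (h0 i)
    have i1 : Integrable (fun ω => ‖∑ i ∈ T, X i ω‖ ^ 2) P := hS.integrable_norm_pow two_ne_zero
    have i2 : Integrable (fun ω => ‖X i ω‖ ^ 2) P := (hX i).integrable_norm_pow two_ne_zero
    have i3 : Integrable (fun ω => ‖∑ i ∈ T, X i ω + X i ω‖ ^ 2) P :=
      (hS.add (hX i)).integrable_norm_pow two_ne_zero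
    have i4 : Integrable (fun ω => ‖∑ i ∈ T, X i ω - X i ω‖ ^ 2) P :=
      (hS.sub (hX i)).integrable_norm_pow two_ne_zero
    -- By Jensen, E‖S - X‖² is at least E‖S‖² and absorbs one of the two copies of E‖S‖² on the
    -- right. A new summand thus costs only 2D E‖X‖².
    have h2 : ∫ ω, (‖∑ i ∈ T, X i ω + X i ω‖ ^ 2 + ‖∑ i ∈ T, X i ω - X i ω‖ ^ 2) ∂P ≤
        ∫ ω, (2 * ‖∑ i ∈ T, X i ω‖ ^ 2 + 2 * D * ‖X i ω‖ ^ 2) ∂P :=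
      integral_mono (i3.add i4) ((i1.const_mul 2).add (i2.const_mul (2 * D)))
        fun ω => hE _ _
    rw [integral_add i3 i4, integral_add (i1.const_mul 2) (i2.const_mul (2 * D)),
      integral_const_mul, integral_const_mul] at h2
    simp only [Finset.sum_insert hi]
    simp only [add_comm (X i _)]
    linarith

end TypeTwo

/-! ### Maximum of finitely many coordinates under second moments -/

section FiniteMaximum

variable {Ω : Type*} [MeasurableSpace Ω] {P : Measure Ω} [IsProbabilityMeasure P]

theorem lintegral_ofReal_le_of_sq {F : Ω → ℝ} (hF : MemLp F 2 P) (hF0 : ∀ ω, 0 ≤ F ω) {A : ℝ}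
    (h : ∫ ω, F ω ^ 2 ∂P ≤ A) : ∫⁻ ω, ENNReal.ofReal (F ω) ∂P ≤ ENNReal.ofReal √A := by
  rw [← ofReal_integral_eq_lintegral_ofReal (hF.integrable one_le_two)
    (Filter.Eventually.of_forall hF0)]
  refine ENNReal.ofReal_le_ofReal (Real.le_sqrt_of_sq_le (le_trans ?_ h))
  have hconv : ConvexOn ℝ Set.univ (fun x : ℝ => x ^ 2) := even_two.convexOn_pow
  exact hconv.map_integral_le (by fun_prop) isClosed_univ
      (Filter.Eventually.of_forall fun _ => Set.mem_univ _) (hF.integrable one_le_two)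
      hF.integrable_sq

/-- A maximal inequality for sums of independent random vectors. -/
theorem lintegral_iSup_abs_sum_le {ι κ : Type*} [Fintype ι] [Fintype κ] {m : ℕ} (hm : 0 < m)
    {X : ι → Ω → κ → ℝ} (hXm : ∀ i, Measurable (X i)) (hind : iIndepFun X P)
    (h0 : ∀ i e, ∫ ω, X i ω e ∂P = 0) {B : ι → Ω → ℝ} (hB : ∀ i, MemLp (B i) 2 P)
    (hXB : ∀ i, ∀ᵐ ω ∂P, ∀ e, |X i ω e| ≤ B i ω) (hB0 : ∀ i ω, 0 ≤ B i ω) :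
    ∫⁻ ω, ⨆ e, ENNReal.ofReal |∑ i, X i ω e| ∂P ≤
      ENNReal.ofReal √(8 * m * (Fintype.card κ : ℝ) ^ (1 / (m : ℝ)) * ∑ i, ∫ ω, B i ω ^ 2 ∂P) := by
  obtain ⟨p, hp⟩ : ∃ p : ℝ≥0∞, p = ((2 * m : ℕ) : ℝ≥0∞) := ⟨_, rfl⟩
  have : Fact (1 ≤ p) := ⟨by rw [hp]; exact_mod_cast (by omega : 1 ≤ 2 * m)⟩
  set V : ι → Ω → PiLp p (fun _ : κ => ℝ) := fun i ω => WithLp.toLp p (X i ω) with hV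
  have hVm : ∀ i, Measurable (V i) := fun i => (WithLp.measurable_toLp p _).comp (hXm i)
  have hVind : iIndepFun V P := hind.comp _ fun i => WithLp.measurable_toLp p _
  -- The passage from the maximum norm to ℓ^(2m) costs card^(1/(2m)), hence card^(1/m) after
  -- squaring.
  have hnorm : ∀ z : PiLp p (fun _ : κ => ℝ), ∀ b : ℝ, 0 ≤ b → (∀ e, |z e| ≤ b) →
      ‖z‖ ^ 2 ≤ (Fintype.card κ : ℝ) ^ (1 / (m : ℝ)) * b ^ 2 := by
    intro z b hb hz
    rw [PiLp.norm_eq_of_nat (2 * m) hp]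
    have h1 : ∑ e, ‖z e‖ ^ (2 * m) ≤ Fintype.card κ * b ^ (2 * m) := by
      refine (Finset.sum_le_sum fun e _ => pow_le_pow_left₀ (norm_nonneg _) (hz e) _).trans ?_
      simp
    have h2 : (∑ e, ‖z e‖ ^ (2 * m)) ^ (1 / ((2 * m : ℕ) : ℝ)) ≤
        (Fintype.card κ * b ^ (2 * m)) ^ (1 / ((2 * m : ℕ) : ℝ)) := by gcongr
    refine (pow_le_pow_left₀ (by positivity) h2 2).trans (le_of_eq ?_)
    rw [Real.mul_rpow (by positivity) (by positivity), mul_pow, ← Real.rpow_natCast,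
      ← Real.rpow_mul (by positivity)]
    congr 1
    · congr 1
      push_cast
      field_simp
    · rw [one_div, Real.pow_rpow_inv_natCast hb (by omega)]
  have hVB : ∀ i, ∀ᵐ ω ∂P, ‖V i ω‖ ^ 2 ≤ (Fintype.card κ : ℝ) ^ (1 / (m : ℝ)) * B i ω ^ 2 :=
    fun i => (hXB i).mono fun ω h => hnorm _ _ (hB0 i ω) h
  have hV2 : ∀ i, MemLp (V i) 2 P := by
    intro i
    refine MemLp.of_le_mul (c := √((Fintype.card κ : ℝ) ^ (1 / (m : ℝ)))) (hB i)
      (hVm i).aestronglyMeasurable ((hVB i).mono fun ω h => ?_)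
    rw [← Real.sqrt_sq (norm_nonneg (V i ω)), Real.norm_of_nonneg (hB0 i ω),
      ← Real.sqrt_sq (hB0 i ω), ← Real.sqrt_mul (by positivity)]
    exact Real.sqrt_le_sqrt h
  have hV0 : ∀ i, ∫ ω, V i ω ∂P = 0 := by
    intro i
    ext e
    have := (PiLp.proj (𝕜 := ℝ) p (fun _ : κ => ℝ) e).integral_comp_comm
      ((hV2 i).integrable one_le_two)
    exact this.symm.trans (h0 i e)
  have hE : ∀ x y : PiLp p (fun _ : κ => ℝ),
      ‖x + y‖ ^ 2 + ‖x - y‖ ^ 2 ≤ 2 * ‖x‖ ^ 2 + 2 * (4 * m) * ‖y‖ ^ 2 :=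
    PiLp.norm_add_sq_add_norm_sub_sq_le hm hp
  have h1 : ∫ ω, ‖∑ i, V i ω‖ ^ 2 ∂P ≤ 2 * (4 * m) * ∑ i, ∫ ω, ‖V i ω‖ ^ 2 ∂P :=
    integral_norm_sum_sq_le hE hVm hV2 hVind hV0 Finset.univ
  have h2 : ∑ i, ∫ ω, ‖V i ω‖ ^ 2 ∂P ≤
      (Fintype.card κ : ℝ) ^ (1 / (m : ℝ)) * ∑ i, ∫ ω, B i ω ^ 2 ∂P := by
    rw [Finset.mul_sum]
    refine Finset.sum_le_sum fun i _ => ?_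
    rw [← integral_const_mul]
    exact integral_mono_ae ((hV2 i).integrable_norm_pow two_ne_zero)
      ((hB i).integrable_sq.const_mul _) (hVB i)
  have h3 : ∫ ω, ‖∑ i, V i ω‖ ^ 2 ∂P ≤
      8 * m * (Fintype.card κ : ℝ) ^ (1 / (m : ℝ)) * ∑ i, ∫ ω, B i ω ^ 2 ∂P := by
    refine h1.trans ?_
    calc _ ≤ 2 * (4 * m : ℝ) * ((Fintype.card κ : ℝ) ^ (1 / (m : ℝ)) * ∑ i, ∫ ω, B i ω ^ 2 ∂P) := by
          gcongr
      _ = _ := by ring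
  refine le_trans (lintegral_mono fun ω => ?_) (lintegral_ofReal_le_of_sq
    (memLp_finsetSum Finset.univ fun i _ => hV2 i).norm (fun ω => norm_nonneg _) h3)
  refine iSup_le fun e => ENNReal.ofReal_le_ofReal ?_
  have h4 := PiLp.norm_apply_le (∑ i, V i ω) e
  have h5 : (∑ i, V i ω) e = ∑ i, X i ω e := by simp [hV]
  rwa [h5] at h4

end FiniteMaximum

/-! ### Maximum of finitely many sub-Gaussian variables -/

section SubgaussianMaximum

variable {Ω : Type*} [MeasurableSpace Ω] {P : Measure Ω} [IsProbabilityMeasure P]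

/-- The exponential of t max |X_e| is at most the sum W of all exp(±t X_e). Bounding log W by its
tangent at `a ≥ E W` makes the estimate linear in W, so integration gives log(a)/t. No independence
is involved. -/
theorem lintegral_iSup_abs_le_of_subgaussian {κ : Type*} [Fintype κ] [Nonempty κ]
    {X : κ → Ω → ℝ} {v : ℝ≥0} (hX : ∀ e, HasSubgaussianMGF (X e) v P) :
    ∫⁻ ω, ⨆ e, ENNReal.ofReal |X e ω| ∂P ≤
      ENNReal.ofReal √(2 * v * Real.log (2 * Fintype.card κ)) := by
  -- For v = 0 the optimal `t` below would be infinite, but all variables vanish almost surely.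
  rcases eq_or_ne v 0 with rfl | hv
  · have h : ∀ᵐ ω ∂P, ⨆ e, ENNReal.ofReal |X e ω| = 0 := by
      have h1 : ∀ᵐ ω ∂P, ∀ e, X e ω = 0 :=
        ae_all_iff.2 fun e => (hX e).ae_eq_zero_of_hasSubgaussianMGF_zero
      filter_upwards [h1] with ω hω
      simp [hω]
    rw [lintegral_congr_ae h]
    simp
  have hv0 : (0 : ℝ) < v := by exact_mod_cast pos_iff_ne_zero.2 hv
  have hN : (1 : ℝ) ≤ Fintype.card κ := by exact_mod_cast Fintype.card_pos
  have hlog : 0 < Real.log (2 * Fintype.card κ) := Real.log_pos (by linarith)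
  set ℓ := Real.log (2 * Fintype.card κ) with hℓ
  -- The minimizer of (ℓ + v t²/2) / t.
  set t := √(2 * ℓ / v) with ht
  have ht0 : 0 < t := Real.sqrt_pos.2 (by positivity)
  have ht2 : t ^ 2 = 2 * ℓ / v := Real.sq_sqrt (by positivity)
  set W : Ω → ℝ := fun ω => ∑ e, (Real.exp (t * X e ω) + Real.exp (-t * X e ω)) with hW
  have hexp : ∀ e, Integrable (fun ω => Real.exp (t * X e ω) + Real.exp (-t * X e ω)) P :=
    fun e => ((hX e).integrable_exp_mul t).add ((hX e).integrable_exp_mul (-t))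
  have hWi : Integrable W P := integrable_finsetSum _ fun e _ => hexp e
  set a := 2 * Fintype.card κ * Real.exp (v * t ^ 2 / 2) with ha
  have ha0 : 0 < a := by positivity
  have hEW : ∫ ω, W ω ∂P ≤ a := by
    simp only [hW]
    rw [integral_finsetSum _ fun e _ => hexp e]
    have h1 : ∀ e ∈ Finset.univ, ∫ ω, (Real.exp (t * X e ω) + Real.exp (-t * X e ω)) ∂P ≤
        2 * Real.exp (v * t ^ 2 / 2) := by
      intro e _
      rw [integral_add ((hX e).integrable_exp_mul t) ((hX e).integrable_exp_mul (-t))]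
      have h2 := (hX e).mgf_le t
      have h3 := (hX e).mgf_le (-t)
      rw [neg_sq] at h3
      simp only [mgf] at h2 h3
      linarith
    refine (Finset.sum_le_sum h1).trans (le_of_eq ?_)
    rw [Finset.sum_const, nsmul_eq_mul, Finset.card_univ, ha]
    ring
  have hpt : ∀ ω e, |X e ω| ≤ t⁻¹ * (Real.log a - 1 + W ω / a) := by
    intro ω e
    have h1 : Real.exp (t * |X e ω|) ≤ W ω := by
      have h2 : Real.exp (t * |X e ω|) ≤ Real.exp (t * X e ω) + Real.exp (-t * X e ω) := by
        rcases abs_choice (X e ω) with h | h <;> rw [h]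
        · linarith [Real.exp_pos (-t * X e ω)]
        · rw [mul_neg, neg_mul]; linarith [Real.exp_pos (t * X e ω)]
      refine h2.trans ?_
      exact Finset.single_le_sum
        (f := fun e => Real.exp (t * X e ω) + Real.exp (-t * X e ω))
        (fun e _ => by positivity) (Finset.mem_univ e)
    have hWpos : 0 < W ω := (Real.exp_pos _).trans_le h1
    have h3 : t * |X e ω| ≤ Real.log (W ω) := (Real.le_log_iff_exp_le hWpos).2 h1
    have h4 := Real.log_le_sub_one_of_pos (div_pos hWpos ha0)
    rw [Real.log_div hWpos.ne' ha0.ne'] at h4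
    rw [le_inv_mul_iff₀ ht0]
    linarith
  have hi : Integrable (fun ω => t⁻¹ * (Real.log a - 1 + W ω / a)) P :=
    ((integrable_const _).add (hWi.div_const _)).const_mul _
  refine (lintegral_mono fun ω => iSup_le fun e => ENNReal.ofReal_le_ofReal (hpt ω e)).trans ?_
  rw [← ofReal_integral_eq_lintegral_ofReal hi (Filter.Eventually.of_forall fun ω =>
    (abs_nonneg _).trans (hpt ω (Classical.arbitrary κ)))]
  refine ENNReal.ofReal_le_ofReal ?_
  rw [integral_const_mul, integral_add (integrable_const _) (hWi.div_const _), integral_div,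
    integral_const, probReal_univ, one_smul]
  have h5 : (∫ ω, W ω ∂P) / a ≤ 1 := (div_le_one ha0).2 hEW
  have h6 : Real.log a = ℓ + v * t ^ 2 / 2 := by
    rw [ha, Real.log_mul (by positivity) (Real.exp_pos _).ne', Real.log_exp]
  have h7 : Real.log a = t * √(2 * v * ℓ) := by
    rw [h6, ht2, ht, ← Real.sqrt_mul (by positivity)]
    have : 2 * ℓ / v * (2 * v * ℓ) = (2 * ℓ) ^ 2 := by field_simp
    rw [this, Real.sqrt_sq (by positivity)]
    field_simp
    ring
  calc t⁻¹ * (Real.log a - 1 + (∫ ω, W ω ∂P) / a) ≤ t⁻¹ * Real.log a := by gcongr; linarith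
    _ = √(2 * v * ℓ) := by rw [h7, inv_mul_cancel_left₀ ht0.ne']

end SubgaussianMaximum

/-! ### Nested dyadic grids on the cube -/

section Grid

variable {d : ℕ}

/-- The node with index `e` of the equidistant grid of mesh `1 / K` on the unit cube. -/
noncomputable def gridNode (K : ℕ) (e : Fin d → Fin (K + 1)) : Fin d → ℝ := fun i => (e i : ℝ) / K

/-- The index of the grid node that lies coordinatewise just below `y`. -/
noncomputable def floorIndex (K : ℕ) (y : Fin d → ℝ) : Fin d → Fin (K + 1) :=
  fun i => Fin.ofNat (K + 1) ⌊y i * K⌋₊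

theorem gridNode_mem_unitCube {K : ℕ} (e : Fin d → Fin (K + 1)) :
    gridNode K e ∈ unitCube d := by
  constructor
  · intro i
    simp only [gridNode, Pi.zero_apply]
    positivity
  · intro i
    have h : ((e i : ℕ) : ℝ) ≤ K := by exact_mod_cast Nat.lt_succ_iff.1 (e i).2
    exact div_le_one_of_le₀ h (Nat.cast_nonneg K)

theorem floorIndex_val {K : ℕ} {y : Fin d → ℝ} (hy : y ∈ unitCube d) (i : Fin d) :
    (floorIndex K y i : ℕ) = ⌊y i * K⌋₊ := by
  simp only [floorIndex, Fin.val_ofNat]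
  -- The reduction modulo K + 1 in `Fin.ofNat` has no effect on the cube, because y i ≤ 1.
  refine Nat.mod_eq_of_lt (Nat.lt_succ_iff.2 (Nat.floor_le_of_le ?_))
  exact mul_le_of_le_one_left (Nat.cast_nonneg K) (hy.2 i)

theorem norm_sub_gridNode_floorIndex_le {K : ℕ} (hK : 0 < K) {y : Fin d → ℝ}
    (hy : y ∈ unitCube d) : ‖y - gridNode K (floorIndex K y)‖ ≤ 1 / K := by
  have hK' : (0 : ℝ) < K := by exact_mod_cast hK
  refine (pi_norm_le_iff_of_nonneg (by positivity)).2 fun i => ?_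
  have h0 : 0 ≤ y i * K := mul_nonneg (hy.1 i) hK'.le
  have h1 := Nat.floor_le h0
  have h2 := Nat.lt_floor_add_one (y i * K)
  have h3 : y i - (⌊y i * K⌋₊ : ℝ) / K = (y i * K - ⌊y i * K⌋₊) / K := by field_simp
  rw [Pi.sub_apply, gridNode, floorIndex_val hy, h3, Real.norm_eq_abs, abs_div,
    abs_of_nonneg (by linarith), abs_of_pos hK']
  gcongr
  linarith

/-- The index, in the grid with half as many cells per coordinate, of the node below `e`. -/
def parentIndex (K : ℕ) (e : Fin d → Fin (2 * K + 1)) : Fin d → Fin (K + 1) :=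
  fun i => Fin.ofNat (K + 1) ((e i : ℕ) / 2)

theorem parentIndex_val {K : ℕ} (e : Fin d → Fin (2 * K + 1)) (i : Fin d) :
    (parentIndex K e i : ℕ) = (e i : ℕ) / 2 := by
  simp only [parentIndex, Fin.val_ofNat]
  refine Nat.mod_eq_of_lt ?_
  have := (e i).2
  omega

theorem parentIndex_floorIndex {K : ℕ} {y : Fin d → ℝ} (hy : y ∈ unitCube d) :
    parentIndex K (floorIndex (2 * K) y) = floorIndex K y := by
  funext i
  apply Fin.ext
  rw [parentIndex_val, floorIndex_val hy, floorIndex_val hy, ← Nat.floor_div_natCast]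
  congr 1
  push_cast
  ring

theorem norm_gridNode_sub_parent_le {K : ℕ} (hK : 0 < K) (e : Fin d → Fin (2 * K + 1)) :
    ‖gridNode (2 * K) e - gridNode K (parentIndex K e)‖ ≤ 1 / K := by
  have hK' : (0 : ℝ) < K := by exact_mod_cast hK
  refine (pi_norm_le_iff_of_nonneg (by positivity)).2 fun i => ?_
  have h1 : ((e i : ℕ) : ℝ) = 2 * ((e i : ℕ) / 2 : ℕ) + ((e i : ℕ) % 2 : ℕ) := by
    exact_mod_cast (Nat.div_add_mod _ 2).symm
  have h2 : (((e i : ℕ) % 2 : ℕ) : ℝ) ≤ 1 := by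
    exact_mod_cast Nat.lt_succ_iff.1 (Nat.mod_lt (e i : ℕ) two_pos)
  have h3 : (gridNode (2 * K) e - gridNode K (parentIndex K e)) i =
      (((e i : ℕ) % 2 : ℕ) : ℝ) / 2 / K := by
    rw [Pi.sub_apply, gridNode, gridNode, parentIndex_val, h1]
    push_cast
    field_simp
    ring
  rw [h3, Real.norm_of_nonneg (by positivity)]
  gcongr
  linarith

end Grid

/-! ### Chaining for sums of Hölder processes -/

section Chaining

variable {d : ℕ}

/-- With m ≥ d/θ, the cardinality factor of level `k` grows at most like 2^(kθ/2), half the rate at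
which θ-Hölder increments shrink. -/
theorem sqrt_card_rpow_le {θ : ℝ} {m : ℕ} (hm : 0 < m) (hmθ : d ≤ θ * m) (k : ℕ) :
    √((Fintype.card (Fin d → Fin (2 * 2 ^ k + 1)) : ℝ) ^ (1 / (m : ℝ))) ≤
      (2 : ℝ) ^ θ * (2 : ℝ) ^ (k * (θ / 2)) := by
  have hm' : (0 : ℝ) < m := by exact_mod_cast hm
  have h1 : (Fintype.card (Fin d → Fin (2 * 2 ^ k + 1)) : ℝ) ≤ ((2 : ℝ) ^ (k + 2)) ^ d := by
    rw [Fintype.card_pi]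
    simp only [Fintype.card_fin, Finset.prod_const, Finset.card_univ]
    push_cast
    gcongr
    have : (1 : ℝ) ≤ 2 ^ k := one_le_pow₀ one_le_two
    rw [pow_add]; linarith
  rw [← Real.rpow_add two_pos]
  refine Real.sqrt_le_left (by positivity) |>.2 ?_
  calc (Fintype.card (Fin d → Fin (2 * 2 ^ k + 1)) : ℝ) ^ (1 / (m : ℝ))
      ≤ (((2 : ℝ) ^ (k + 2)) ^ d) ^ (1 / (m : ℝ)) := by gcongr
    _ = (2 : ℝ) ^ (((k : ℝ) + 2) * (d / m)) := by
        rw [← pow_mul, ← Real.rpow_natCast, ← Real.rpow_mul two_pos.le]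
        congr 1
        push_cast
        ring
    _ ≤ (2 : ℝ) ^ (((k : ℝ) + 2) * θ) := by
        refine Real.rpow_le_rpow_of_exponent_le one_le_two ?_
        gcongr
        exact (div_le_iff₀ hm').2 hmθ
    _ = ((2 : ℝ) ^ (θ + k * (θ / 2))) ^ 2 := by
        rw [← Real.rpow_natCast, ← Real.rpow_mul two_pos.le]
        congr 1
        push_cast
        ring

/-- Sums of independent centered processes with Hölder continuous paths satisfy a maximal
inequality of the order of the square root of the sum of the second moments. -/
theorem exists_lintegral_cubeSupNorm_sum_le (d : ℕ) {θ : ℝ} (hθ : 0 < θ) :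
    ∃ C : ℝ, 0 < C ∧ ∀ {Ω : Type*} [MeasurableSpace Ω] (P : Measure Ω) [IsProbabilityMeasure P]
      {ι : Type} [Fintype ι] (G : ι → Ω → (Fin d → ℝ) → ℝ) (B : ι → Ω → ℝ),
      (∀ i, ∀ x ∈ unitCube d, Measurable fun ω => G i ω x) →
      iIndepFun (fun i ω (x : unitCube d) => G i ω x) P →
      (∀ i, ∀ x ∈ unitCube d, ∫ ω, G i ω x ∂P = 0) →
      (∀ i, MemLp (B i) 2 P) → (∀ i ω, 0 ≤ B i ω) →
      (∀ i, ∀ᵐ ω ∂P, ∀ x ∈ unitCube d, |G i ω x| ≤ B i ω) →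
      (∀ i, ∀ᵐ ω ∂P, ∀ x ∈ unitCube d, ∀ y ∈ unitCube d,
        |G i ω x - G i ω y| ≤ B i ω * ‖x - y‖ ^ θ) →
      ∫⁻ ω, cubeSupNorm (fun y => ∑ i, G i ω y) ∂P ≤
        ENNReal.ofReal (C * √(∑ i, ∫ ω, B i ω ^ 2 ∂P)) := by
  obtain ⟨m₀, hm₀⟩ := exists_nat_ge ((d : ℝ) / θ)
  set m := m₀ + 1 with hm
  have hm1 : 0 < m := Nat.succ_pos _
  have hmθ : (d : ℝ) ≤ θ * m := by
    rw [div_le_iff₀ hθ] at hm₀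
    rw [hm]; push_cast; nlinarith
  -- The ratio of the chaining series: growth 2^(θ/2) of the cardinality factor times decay 2^(-θ)
  -- of the increments.
  set ρ : ℝ := (2 : ℝ) ^ (-(θ / 2)) with hρ
  have hρ0 : 0 < ρ := Real.rpow_pos_of_pos two_pos _
  have hρ1 : ρ < 1 := Real.rpow_lt_one_of_one_lt_of_neg one_lt_two (by linarith)
  set C₀ : ℝ := √(8 * m) * (2 : ℝ) ^ θ with hC₀
  have hC₀0 : 0 < C₀ := by positivity
  have h1ρ : 0 < 1 - ρ := by linarith
  refine ⟨C₀ + C₀ / (1 - ρ), by positivity, ?_⟩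
  intro Ω _ P _ ι _ G B hGm hind hG0 hB hB0 hGB hGH
  set A := ∑ i, ∫ ω, B i ω ^ 2 ∂P with hA
  have hA0 : 0 ≤ A := Finset.sum_nonneg fun i _ => integral_nonneg fun ω => sq_nonneg _
  set S : Ω → (Fin d → ℝ) → ℝ := fun ω y => ∑ i, G i ω y with hS
  have hSm : ∀ x ∈ unitCube d, Measurable fun ω => S ω x := fun x hx =>
    Finset.measurable_sum _ fun i _ => hGm i x hx
  have hGi : ∀ i, ∀ x ∈ unitCube d, Integrable (fun ω => G i ω x) P := fun i x hx =>
    ((hB i).integrable one_le_two).mono' (hGm i x hx).aestronglyMeasurable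
      ((hGB i).mono fun ω h => h x hx)
  have hmeas : ∀ {κ : Type} [Fintype κ] (a : κ → Ω → ℝ), (∀ e, Measurable (a e)) →
      Measurable fun ω => ⨆ e, ENNReal.ofReal |a e ω| := fun a ha =>
    Measurable.iSup fun e => ((ha e).abs).ennreal_ofReal
  set U₀ : Ω → ℝ≥0∞ := fun ω => ⨆ e : Fin d → Fin (2 * 2 ^ 0 + 1),
    ENNReal.ofReal |S ω (gridNode (2 * 2 ^ 0) e)| with hU₀
  set U : ℕ → Ω → ℝ≥0∞ := fun k ω => ⨆ e : Fin d → Fin (2 * 2 ^ k + 1),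
    ENNReal.ofReal |S ω (gridNode (2 * 2 ^ k) e) - S ω (gridNode (2 ^ k) (parentIndex (2 ^ k) e))|
    with hU
  have hU₀m : Measurable U₀ := hmeas _ fun e => hSm _ (gridNode_mem_unitCube e)
  have hUm : ∀ k, Measurable (U k) := fun k => hmeas _ fun e =>
    (hSm _ (gridNode_mem_unitCube e)).sub (hSm _ (gridNode_mem_unitCube _))
  have hU₀E : ∫⁻ ω, U₀ ω ∂P ≤ ENNReal.ofReal (C₀ * √A) := by
    have h := lintegral_iSup_abs_sum_le (P := P) hm1 (κ := Fin d → Fin (2 * 2 ^ 0 + 1))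
      (X := fun i ω e => G i ω (gridNode (2 * 2 ^ 0) e))
      (fun i => measurable_pi_lambda _ fun e => hGm i _ (gridNode_mem_unitCube e))
      (hind.comp (fun _ g e => g ⟨gridNode (2 * 2 ^ 0) e, gridNode_mem_unitCube e⟩)
        fun _ => measurable_pi_lambda _ fun e => measurable_pi_apply _)
      (fun i e => hG0 i _ (gridNode_mem_unitCube e)) hB
      (fun i => (hGB i).mono fun ω hω e => hω _ (gridNode_mem_unitCube e)) hB0
    refine h.trans (ENNReal.ofReal_le_ofReal ?_)
    rw [Real.sqrt_mul (by positivity), Real.sqrt_mul (by positivity), hC₀]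
    gcongr
    simpa using sqrt_card_rpow_le hm1 hmθ 0
  have hUE : ∀ k, ∫⁻ ω, U k ω ∂P ≤ ENNReal.ofReal (C₀ * √A * ρ ^ k) := by
    intro k
    have hk2 : (0 : ℕ) < 2 ^ k := by positivity
    have hk0 : (0 : ℝ) ≤ (1 / (2 ^ k : ℕ) : ℝ) ^ θ := by positivity
    have h := lintegral_iSup_abs_sum_le (P := P) hm1 (κ := Fin d → Fin (2 * 2 ^ k + 1))
      (X := fun i ω e => G i ω (gridNode (2 * 2 ^ k) e) -
        G i ω (gridNode (2 ^ k) (parentIndex (2 ^ k) e)))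
      (B := fun i ω => (1 / (2 ^ k : ℕ) : ℝ) ^ θ * B i ω)
      (fun i => measurable_pi_lambda _ fun e => (hGm i _ (gridNode_mem_unitCube e)).sub
        (hGm i _ (gridNode_mem_unitCube _)))
      (hind.comp (fun _ g e => g ⟨gridNode (2 * 2 ^ k) e, gridNode_mem_unitCube e⟩ -
          g ⟨gridNode (2 ^ k) (parentIndex (2 ^ k) e), gridNode_mem_unitCube _⟩)
        fun _ => measurable_pi_lambda _ fun e => (measurable_pi_apply _).sub (measurable_pi_apply _))
      (fun i e => by
        rw [integral_sub (hGi i _ (gridNode_mem_unitCube e)) (hGi i _ (gridNode_mem_unitCube _)),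
          hG0 i _ (gridNode_mem_unitCube e), hG0 i _ (gridNode_mem_unitCube _), sub_zero])
      (fun i => (hB i).const_mul _)
      (fun i => (hGH i).mono fun ω hω e => by
        refine (hω _ (gridNode_mem_unitCube e) _ (gridNode_mem_unitCube _)).trans ?_
        rw [mul_comm]
        refine mul_le_mul_of_nonneg_right ?_ (hB0 i ω)
        exact Real.rpow_le_rpow (norm_nonneg _) (norm_gridNode_sub_parent_le hk2 e) hθ.le)
      (fun i ω => mul_nonneg hk0 (hB0 i ω))
    simp only [Finset.sum_sub_distrib] at h
    refine h.trans (ENNReal.ofReal_le_ofReal ?_)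
    simp only [mul_pow, integral_const_mul, ← Finset.mul_sum]
    rw [← hA, Real.sqrt_mul (by positivity) (((1 / (2 ^ k : ℕ) : ℝ) ^ θ) ^ 2 * A),
      Real.sqrt_mul (by positivity) ((Fintype.card _ : ℝ) ^ _), Real.sqrt_mul (by positivity) A,
      Real.sqrt_sq hk0, hC₀]
    have e1 : (1 / (2 ^ k : ℕ) : ℝ) ^ θ = (2 : ℝ) ^ (-(k * θ)) := by
      rw [one_div, Nat.cast_pow, Nat.cast_two, ← Real.rpow_natCast, ← Real.rpow_neg two_pos.le,
        ← Real.rpow_mul two_pos.le, neg_mul]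
    have e2 : ρ ^ k = (2 : ℝ) ^ (k * (θ / 2)) * (2 : ℝ) ^ (-(k * θ)) := by
      rw [hρ, ← Real.rpow_natCast, ← Real.rpow_mul two_pos.le, ← Real.rpow_add two_pos]
      congr 1
      ring
    rw [e1, e2]
    calc _ ≤ √(8 * m) * ((2 : ℝ) ^ θ * (2 : ℝ) ^ (k * (θ / 2))) * ((2 : ℝ) ^ (-(k * θ)) * √A) := by
          gcongr
          exact sqrt_card_rpow_le hm1 hmθ k
      _ = _ := by ring
  set R := ∑ i, ∫ ω, B i ω ∂P with hR
  -- After `K` levels the distance to the grid is bounded crudely by the sum of all Hölder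
  -- constants. This depends on the number of processes but vanishes as K → ∞.
  have hbound : ∀ K : ℕ, ∫⁻ ω, cubeSupNorm (fun y => S ω y) ∂P ≤
      ENNReal.ofReal ((C₀ + C₀ / (1 - ρ)) * √A + ((2 : ℝ) ^ (-θ)) ^ K * R) := by
    intro K
    have hpt : ∀ᵐ ω ∂P, cubeSupNorm (fun y => S ω y) ≤
        (U₀ ω + ∑ k ∈ Finset.range K, U k ω) +
          ENNReal.ofReal (((2 : ℝ) ^ (-θ)) ^ K * ∑ i, B i ω) := by
      filter_upwards [ae_all_iff.2 hGH] with ω hω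
      refine iSup₂_le fun y hy => ?_
      have h1 : ENNReal.ofReal |S ω (gridNode (2 ^ K) (floorIndex (2 ^ K) y))| ≤
          U₀ ω + ∑ k ∈ Finset.range K, U k ω := by
        have hstep : ∀ k, ENNReal.ofReal |S ω (gridNode (2 * 2 ^ k) (floorIndex (2 * 2 ^ k) y)) -
            S ω (gridNode (2 ^ k) (floorIndex (2 ^ k) y))| ≤ U k ω := by
          intro k
          rw [← parentIndex_floorIndex (K := 2 ^ k) hy]
          exact le_iSup (fun e : Fin d → Fin (2 * 2 ^ k + 1) => ENNReal.ofReal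
            |S ω (gridNode (2 * 2 ^ k) e) - S ω (gridNode (2 ^ k) (parentIndex (2 ^ k) e))|)
            (floorIndex (2 * 2 ^ k) y)
        induction K with
        | zero =>
          rw [Finset.range_zero, Finset.sum_empty, add_zero]
          -- The starting node lies on the grid of mesh 1, which is contained in the grid of mesh
          -- 1/2 over which `U₀` runs.
          set e : Fin d → Fin (2 * 2 ^ 0 + 1) := fun i =>
            Fin.ofNat _ (2 * (floorIndex (2 ^ 0) y i : ℕ)) with he
          have h2 : gridNode (2 ^ 0) (floorIndex (2 ^ 0) y) = gridNode (2 * 2 ^ 0) e := by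
            funext i
            have h3 : (e i : ℕ) = 2 * (floorIndex (2 ^ 0) y i : ℕ) := by
              simp only [he, Fin.val_ofNat]
              refine Nat.mod_eq_of_lt ?_
              have := (floorIndex (2 ^ 0) y i).2
              omega
            rw [gridNode, gridNode, h3]
            push_cast
            ring
          rw [h2]
          exact le_iSup (fun e : Fin d → Fin (2 * 2 ^ 0 + 1) =>
            ENNReal.ofReal |S ω (gridNode (2 * 2 ^ 0) e)|) e
        | succ k ih =>
          rw [Finset.sum_range_succ, ← add_assoc, pow_succ']
          refine le_trans ?_ (add_le_add ih (hstep k))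
          rw [← ENNReal.ofReal_add (abs_nonneg _) (abs_nonneg _)]
          refine ENNReal.ofReal_le_ofReal ?_
          have := abs_add_le (S ω (gridNode (2 ^ k) (floorIndex (2 ^ k) y)))
            (S ω (gridNode (2 * 2 ^ k) (floorIndex (2 * 2 ^ k) y)) -
            S ω (gridNode (2 ^ k) (floorIndex (2 ^ k) y)))
          rwa [add_sub_cancel] at this
      have h2 : |S ω y - S ω (gridNode (2 ^ K) (floorIndex (2 ^ K) y))| ≤
          ((2 : ℝ) ^ (-θ)) ^ K * ∑ i, B i ω := by
        simp only [hS, ← Finset.sum_sub_distrib]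
        rw [Finset.mul_sum]
        refine (Finset.abs_sum_le_sum_abs _ _).trans (Finset.sum_le_sum fun i _ => ?_)
        refine (hω i y hy _ (gridNode_mem_unitCube _)).trans ?_
        rw [mul_comm]
        refine mul_le_mul_of_nonneg_right ?_ (hB0 i ω)
        refine (Real.rpow_le_rpow (norm_nonneg _)
          (norm_sub_gridNode_floorIndex_le (K := 2 ^ K) (by positivity) hy) hθ.le).trans
            (le_of_eq ?_)
        rw [one_div, Nat.cast_pow, Nat.cast_two, ← Real.rpow_natCast, ← Real.rpow_natCast,
          ← Real.rpow_neg two_pos.le, ← Real.rpow_mul two_pos.le, ← Real.rpow_mul two_pos.le]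
        congr 1
        ring
      refine le_trans ?_ (add_le_add h1 (ENNReal.ofReal_le_ofReal h2))
      rw [← ENNReal.ofReal_add (abs_nonneg _) (abs_nonneg _)]
      refine ENNReal.ofReal_le_ofReal ?_
      have := abs_add_le (S ω (gridNode (2 ^ K) (floorIndex (2 ^ K) y)))
        (S ω y - S ω (gridNode (2 ^ K) (floorIndex (2 ^ K) y)))
      rwa [add_sub_cancel] at this
    have hBi : Integrable (fun ω => ((2 : ℝ) ^ (-θ)) ^ K * ∑ i, B i ω) P :=
      (integrable_finsetSum _ fun i _ => (hB i).integrable one_le_two).const_mul _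
    have hsum : Measurable fun ω => U₀ ω + ∑ k ∈ Finset.range K, U k ω :=
      hU₀m.add (Finset.measurable_sum _ fun k _ => hUm k)
    refine (lintegral_mono_ae hpt).trans ?_
    rw [lintegral_add_left hsum, lintegral_add_left hU₀m,
      lintegral_finsetSum _ fun k _ => hUm k,
      ← ofReal_integral_eq_lintegral_ofReal hBi (Filter.Eventually.of_forall fun ω =>
        mul_nonneg (by positivity) (Finset.sum_nonneg fun i _ => hB0 i ω)),
      integral_const_mul, integral_finsetSum _ fun i _ => (hB i).integrable one_le_two, ← hR]
    have hR0 : 0 ≤ R := Finset.sum_nonneg fun i _ => integral_nonneg (hB0 i)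
    rw [ENNReal.ofReal_add (by positivity) (by positivity)]
    gcongr
    rw [add_mul, ENNReal.ofReal_add (by positivity) (by positivity)]
    refine add_le_add hU₀E ((Finset.sum_le_sum fun k _ => hUE k).trans ?_)
    rw [← ENNReal.ofReal_sum_of_nonneg fun k _ => by positivity, ← Finset.mul_sum]
    refine ENNReal.ofReal_le_ofReal ?_
    rw [div_mul_eq_mul_div, div_eq_mul_inv]
    gcongr
    have := (summable_geometric_of_lt_one hρ0.le hρ1).sum_le_tsum (Finset.range K)
      fun k _ => by positivity
    rwa [tsum_geometric_of_lt_one hρ0.le hρ1] at this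
  have hlim : Filter.Tendsto (fun K : ℕ => ENNReal.ofReal ((C₀ + C₀ / (1 - ρ)) * √A +
      ((2 : ℝ) ^ (-θ)) ^ K * R)) Filter.atTop
      (nhds (ENNReal.ofReal ((C₀ + C₀ / (1 - ρ)) * √A + 0 * R))) := by
    refine ENNReal.tendsto_ofReal ((Filter.Tendsto.mul_const R ?_).const_add _)
    exact tendsto_pow_atTop_nhds_zero_of_lt_one (by positivity)
      (Real.rpow_lt_one_of_one_lt_of_neg one_lt_two (by linarith))
  rw [zero_mul, add_zero] at hlim
  exact ge_of_tendsto' hlim hbound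

end Chaining

/-! ### Polynomial reproducing weights on a regular design -/

section Weights

variable {d : ℕ} {p : Fin d → ℕ} {x : (k : Fin d) → Fin (p k) → ℝ} {s : Fin d → ℕ} {m : ℕ}
  {c h₀ C₁ C₂ Cd h : ℝ} {w : ℝ → (Fin d → ℝ) → GridIndex p → ℝ}

theorem pMin_le (k : Fin d) : pMin p ≤ p k := ciInf_le (OrderBot.bddBelow _) k

theorem pMin_pow_le_gridSize : pMin p ^ d ≤ gridSize p := by
  have := Finset.prod_le_prod (s := Finset.univ) (f := fun _ : Fin d => pMin p) (g := p)
    (fun _ _ => Nat.zero_le _) fun k _ => pMin_le k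
  simpa [gridSize] using this

theorem pMin_le_gridSize (hd : 0 < d) : pMin p ≤ gridSize p :=
  (Nat.le_self_pow hd.ne' _).trans pMin_pow_le_gridSize

theorem RegularDesign.gridPoint_mem (hx : RegularDesign Cd x) (j : GridIndex p) :
    gridPoint x j ∈ unitCube d :=
  ⟨fun k => (hx.mem_unit k (j k)).1, fun k => (hx.mem_unit k (j k)).2⟩

/-- The design condition needs a radius of at least 1/p_min, while the bandwidth only exceeds
c/p_min. Enlarging the window by max(1, 1/c) closes the gap. -/
theorem RegularDesign.card_norm_le (hx : RegularDesign Cd x) (hc : 0 < c)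
    (hh : c / pMin p < h) {ρ : ℝ} (hρ : h ≤ ρ) {y : Fin d → ℝ} (hy : y ∈ unitCube d) :
    ((Finset.univ.filter fun j : GridIndex p => ‖y - gridPoint x j‖ ≤ ρ).card : ℝ) ≤
      Cd * (max 1 (1 / c) * ρ) ^ d * gridSize p := by
  have hh0 : 0 < h := lt_of_le_of_lt (by positivity) hh
  have hρ0 : 0 < ρ := hh0.trans_le hρ
  have hΓ : (1 : ℝ) ≤ max 1 (1 / c) := le_max_left _ _
  have h1 : 1 / (pMin p : ℝ) ≤ max 1 (1 / c) * ρ := by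
    calc 1 / (pMin p : ℝ) = 1 / c * (c / pMin p) := by field_simp
      _ ≤ max 1 (1 / c) * ρ := by
        gcongr
        · exact le_max_right _ _
        · exact hh.le.trans hρ
  refine le_trans ?_ (hx.card_le y hy _ (by positivity) h1)
  rw [← Set.ncard_coe_finset]
  refine Nat.cast_le.2 (Set.ncard_le_ncard (fun j hj => ?_) (Set.toFinite _))
  have hj' : ‖y - gridPoint x j‖ ≤ ρ := by simpa using hj
  have hρ' : ρ ≤ max 1 (1 / c) * ρ := le_mul_of_one_le_left hρ0.le hΓ
  have h2 : ∀ k, |y k - gridPoint x j k| ≤ max 1 (1 / c) * ρ := fun k =>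
    (norm_le_pi_norm (y - gridPoint x j) k).trans (hj'.trans hρ')
  exact ⟨fun k => by have := (abs_le.1 (h2 k)).2; linarith,
    fun k => by have := (abs_le.1 (h2 k)).1; linarith⟩

theorem RegularDesign.abs_sum_mul_le (hx : RegularDesign Cd x) (hc : 0 < c)
    (hh : c / pMin p < h) {ρ : ℝ} (hρ : h ≤ ρ) {y : Fin d → ℝ} (hy : y ∈ unitCube d)
    {u g : GridIndex p → ℝ} {b g₀ : ℝ} (hb : 0 ≤ b) (hg₀ : 0 ≤ g₀)
    (hu : ∀ j, ρ < ‖y - gridPoint x j‖ → u j = 0) (hub : ∀ j, |u j| ≤ b)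
    (hg : ∀ j, ‖y - gridPoint x j‖ ≤ ρ → |g j| ≤ g₀) :
    |∑ j, u j * g j| ≤ Cd * (max 1 (1 / c) * ρ) ^ d * gridSize p * (b * g₀) := by
  have h1 : ∑ j, u j * g j =
      ∑ j ∈ Finset.univ.filter (fun j : GridIndex p => ‖y - gridPoint x j‖ ≤ ρ), u j * g j := by
    refine (Finset.sum_subset (Finset.filter_subset _ _) fun j _ hj => ?_).symm
    rw [hu j (by simpa using hj), zero_mul]
  rw [h1]
  refine (Finset.abs_sum_le_sum_abs _ _).trans ?_
  have h2 : ∀ j ∈ Finset.univ.filter (fun j : GridIndex p => ‖y - gridPoint x j‖ ≤ ρ),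
      |u j * g j| ≤ b * g₀ := by
    intro j hj
    rw [abs_mul]
    exact mul_le_mul (hub j) (hg j (Finset.mem_filter.1 hj).2) (abs_nonneg _) hb
  refine (Finset.sum_le_card_nsmul _ _ _ h2).trans ?_
  rw [nsmul_eq_mul]
  exact mul_le_mul_of_nonneg_right (hx.card_norm_le hc hh hρ hy) (mul_nonneg hb hg₀)

theorem pow_mul_div_pow_mul_rpow {h N A C : ℝ} (hh : 0 < h) (hN : 0 < N) (d s : ℕ) (e : ℝ) :
    A * h ^ d * N * (C / (N * h ^ (d + s)) * h ^ e) = A * C * h ^ (e - s) := by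
  rw [Real.rpow_sub hh, Real.rpow_natCast, pow_add]
  field_simp

section Reproduction

variable (hx : RegularDesign Cd x) (hw : WeightConditions x s m c h₀ C₁ C₂ w) (hc : 0 < c)
  (hC₁ : 0 < C₁) (hC₂ : 0 < C₂) (hp : 0 < gridSize p) (hh : c / pMin p < h)
  (hh₀ : h ≤ h₀) {β M : ℝ} {f : (Fin d → ℝ) → ℝ} (hd : 0 < d) (hβ : 0 < β)
  (hf : HolderClass β M f) (hM : 0 ≤ M) {b : ℕ} (hb : b ≤ strictFloor β) (hbm : b ≤ m)

include hx hw hc hC₁ hp hh hh₀ hd hβ hf hM hb hbm in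
/-- Weights that reproduce polynomials estimate the derivative of Hölder functions. -/
theorem WeightConditions.abs_sum_mul_sub_le {y : Fin d → ℝ} (hy : y ∈ unitCube d) :
    |∑ j, w h y j * f (gridPoint x j) - if multiLength s ≤ b then partialDeriv s f y else 0| ≤
      Cd * max 1 (1 / c) ^ d * C₁ * d ^ (b + 1) * M *
        h ^ (b + min 1 (β - b) - (multiLength s : ℝ)) := by
  have hh0 : 0 < h := lt_of_le_of_lt (by positivity) hh
  have hp' : (0 : ℝ) < gridSize p := by exact_mod_cast hp
  have hγ : 0 ≤ min 1 (β - b) := by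
    have := (le_strictFloor_iff hβ b).1 hb
    exact le_min zero_le_one (by linarith)
  have h1 := sum_mul_cubeTaylor (hf.1.of_le (by exact_mod_cast hb)) hy (w h y)
    (fun j => gridPoint x j) s fun k hk σ =>
      sum_mul_prod_eq (hw.reproduce h hh hh₀ y hy) (hk.trans hbm) σ
  rw [← h1, ← Finset.sum_sub_distrib]
  simp only [← mul_sub]
  refine (hx.abs_sum_mul_le hc hh le_rfl hy
    (g₀ := d ^ (b + 1) * M * h ^ (b + min 1 (β - b))) (b := C₁ / (gridSize p * h ^ (d + multiLength s)))
    (by positivity) (by positivity) (hw.localize h hh hh₀ y hy) (hw.bounded h hh hh₀ y hy)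
    fun j hj => ?_).trans (le_of_eq ?_)
  · refine (hf.abs_sub_cubeTaylor_le hβ hd hM hb (hx.gridPoint_mem j) hy).trans ?_
    rw [norm_sub_rev]
    gcongr
  · have := pow_mul_div_pow_mul_rpow (A := Cd * max 1 (1 / c) ^ d * (d ^ (b + 1) * M)) (C := C₁)
      hh0 hp' d (multiLength s) (b + min 1 (β - b))
    rw [mul_pow]
    linear_combination this

include hx hw hc hC₂ hp hh hh₀ hd hβ hf hM hb hbm in
-- For b ≤ |s| the weights at `y` and at `z` give the same value on the Taylor polynomial of `f` at
-- `y`. The difference of the weights therefore meets only the remainder, so the power of `h` from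
-- the smoothness of `f` is kept.
theorem WeightConditions.abs_sum_mul_sub_sum_mul_le (hbs : b ≤ multiLength s) {y z : Fin d → ℝ}
    (hy : y ∈ unitCube d) (hz : z ∈ unitCube d) (hyz : ‖y - z‖ ≤ h) :
    |∑ j, w h y j * f (gridPoint x j) - ∑ j, w h z j * f (gridPoint x j)| ≤
      Cd * max 1 (1 / c) ^ d * 2 ^ d * C₂ * d ^ (b + 1) * 2 ^ (b + min 1 (β - b)) * M *
        h ^ (b + min 1 (β - b) - (multiLength s : ℝ)) * (‖y - z‖ / h) := by
  have hh0 : 0 < h := lt_of_le_of_lt (by positivity) hh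
  have hp' : (0 : ℝ) < gridSize p := by exact_mod_cast hp
  have hγ : 0 ≤ min 1 (β - b) := by
    have := (le_strictFloor_iff hβ b).1 hb
    exact le_min zero_le_one (by linarith)
  have hfb : ContDiffOn ℝ b f (unitCube d) := hf.1.of_le (by exact_mod_cast hb)
  have h1 := sum_mul_cubeTaylor hfb hy (w h y) (fun j => gridPoint x j) s fun k hk σ =>
      sum_mul_prod_eq (hw.reproduce h hh hh₀ y hy) (hk.trans hbm) σ
  have h2 := sum_mul_cubeTaylor hfb hy (w h z) (fun j => gridPoint x j) s fun k hk σ =>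
      sum_mul_prod_eq_of_le (hw.reproduce h hh hh₀ z hz) y (hk.trans hbm) (hk.trans hbs) σ
  have h3 : ∑ j, w h y j * f (gridPoint x j) - ∑ j, w h z j * f (gridPoint x j) =
      ∑ j, (w h y j - w h z j) * (f (gridPoint x j) - cubeTaylor b f y (gridPoint x j)) := by
    have h4 := h1.trans h2.symm
    simp only [sub_mul, mul_sub, Finset.sum_sub_distrib]
    linarith
  rw [h3]
  -- Both windows lie within distance 2h of `y`, as ‖y - z‖ ≤ h.
  refine (hx.abs_sum_mul_le hc hh (ρ := 2 * h) (by linarith) hy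
    (g₀ := d ^ (b + 1) * M * (2 * h) ^ (b + min 1 (β - b)))
    (b := C₂ / (gridSize p * h ^ (d + multiLength s)) * (‖y - z‖ / h))
    (by positivity) (by positivity) (fun j hj => ?_) (fun j => ?_) fun j hj => ?_).trans
      (le_of_eq ?_)
  · rw [hw.localize h hh hh₀ y hy j (by linarith), hw.localize h hh hh₀ z hz j, sub_zero]
    have := norm_sub_le_norm_sub_add_norm_sub y z (gridPoint x j)
    linarith
  · refine (hw.lipschitz h hh hh₀ y hy z hz j).trans ?_
    gcongr
    exact min_le_left _ _
  · refine (hf.abs_sub_cubeTaylor_le hβ hd hM hb (hx.gridPoint_mem j) hy).trans ?_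
    rw [norm_sub_rev]
    gcongr
  · have := pow_mul_div_pow_mul_rpow
      (A := Cd * max 1 (1 / c) ^ d * 2 ^ d * (d ^ (b + 1) * 2 ^ (b + min 1 (β - b)) * M *
        (‖y - z‖ / h))) (C := C₂)
      hh0 hp' d (multiLength s) (b + min 1 (β - b))
    rw [mul_pow, mul_pow, Real.mul_rpow two_pos.le hh0.le]
    linear_combination this

end Reproduction

end Weights

/-! ### Smoothing of Hölder paths by the weights -/

section HolderProcess

/-- The weights map Hölder functions to bounded Hölder continuous functions, up to a factor that
depends on the bandwidth. -/
theorem exists_holder_bound_sum_mul {d : ℕ} (hd : 0 < d) {β β₁ c C₁ C₂ Cd : ℝ} (hβ₁ : 0 < β₁)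
    (hβ : β₁ < β) (hc : 0 < c) (hC₁ : 0 < C₁) (hC₂ : 0 < C₂) (hCd : 0 < Cd) (s : Fin d → ℕ) :
    ∃ θ : ℝ, 0 < θ ∧ ∃ K : ℝ, 0 < K ∧ ∀ {p : Fin d → ℕ} {x : (k : Fin d) → Fin (p k) → ℝ} {m : ℕ}
      {h₀ h : ℝ} {w : ℝ → (Fin d → ℝ) → GridIndex p → ℝ}, RegularDesign Cd x →
      multiLength s ≤ m → WeightConditions x s m c h₀ C₁ C₂ w → 0 < gridSize p →
      c / pMin p < h → h ≤ h₀ → h ≤ 1 → ∀ {M : ℝ} {f : (Fin d → ℝ) → ℝ}, HolderClass β M f → 0 ≤ M →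
      (∀ y ∈ unitCube d, |∑ j, w h y j * f (gridPoint x j)| ≤
        K * h ^ (min (multiLength s : ℝ) β₁ - multiLength s) * M) ∧
      ∀ y ∈ unitCube d, ∀ z ∈ unitCube d,
        |∑ j, w h y j * f (gridPoint x j) - ∑ j, w h z j * f (gridPoint x j)| ≤
        K * h ^ (min (multiLength s : ℝ) β₁ - multiLength s) * M * ‖y - z‖ ^ θ := by
  have hβ0 : 0 < β := hβ₁.trans hβ
  set Γ := max 1 (1 / c) with hΓ
  have hΓ0 : 0 < Γ := lt_of_lt_of_le one_pos (le_max_left _ _)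
  have hd' : (0 : ℝ) < d := by exact_mod_cast hd
  -- If |s| ≤ ⌊β⌋, the smoothed function is within O(h^γ) of ∂^s f, which is itself γ-Hölder. No
  -- negative power of `h` is needed; the power in the claim is at least one.
  rcases le_or_gt (multiLength s) (strictFloor β) with hs | hs
  · set γ := min 1 (β - multiLength s) with hγ
    have hsβ := (le_strictFloor_iff hβ0 _).1 hs
    have hγ0 : 0 < γ := lt_min one_pos (by linarith)
    have hγ1 : γ ≤ 1 := min_le_left _ _
    set K₁ := Cd * Γ ^ d * C₁ * d ^ (multiLength s + 1) with hK₁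
    set K₂ := Cd * Γ ^ d * 2 ^ d * C₂ * d ^ (multiLength s + 1) * (2 : ℝ) ^ (multiLength s + γ)
      with hK₂
    have hK₁0 : 0 < K₁ := by positivity
    have hK₂0 : 0 < K₂ := by positivity
    refine ⟨γ, hγ0, 1 + d + 2 * K₁ + K₂, by positivity, ?_⟩
    intro p x m h₀ h w hx hsm hw hp hh hh₀ hh1 M f hf hM
    have hh0 : 0 < h := lt_of_le_of_lt (by positivity) hh
    have hψ : 1 ≤ h ^ (min (multiLength s : ℝ) β₁ - multiLength s) :=
      Real.one_le_rpow_of_pos_of_le_one_of_nonpos hh0 hh1 (by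
        have := min_le_left (multiLength s : ℝ) β₁; linarith)
    have key1 : ∀ y ∈ unitCube d,
        |∑ j, w h y j * f (gridPoint x j) - partialDeriv s f y| ≤ K₁ * M * h ^ γ := by
      intro y hy
      have := hw.abs_sum_mul_sub_le hx hc hC₁ hp hh hh₀ hd hβ0 hf hM hs hsm hy
      rwa [if_pos le_rfl, ← hγ, add_sub_cancel_left] at this
    have hhγ : h ^ γ ≤ 1 := Real.rpow_le_one hh0.le hh1 hγ0.le
    refine ⟨fun y hy => ?_, fun y hy z hz => ?_⟩
    · have h1 := key1 y hy
      have h2 := hf.abs_partialDeriv_le hM hs hy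
      have h3 := abs_add_le (∑ j, w h y j * f (gridPoint x j) - partialDeriv s f y)
        (partialDeriv s f y)
      rw [sub_add_cancel] at h3
      have h4 : K₁ * M * h ^ γ ≤ K₁ * M := mul_le_of_le_one_right (by positivity) hhγ
      have h5 : (1 + K₁) * M ≤
          (1 + d + 2 * K₁ + K₂) * h ^ (min (multiLength s : ℝ) β₁ - multiLength s) * M := by
        gcongr
        calc 1 + K₁ ≤ 1 + d + 2 * K₁ + K₂ := by linarith
          _ ≤ _ := le_mul_of_one_le_right (by positivity) hψ
      linarith
    · have hgoal : ∀ K, 0 ≤ K → K ≤ 1 + d + 2 * K₁ + K₂ → K * M * ‖y - z‖ ^ γ ≤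
          (1 + d + 2 * K₁ + K₂) * h ^ (min (multiLength s : ℝ) β₁ - multiLength s) * M *
            ‖y - z‖ ^ γ := by
        intro K hK0 hK
        gcongr
        exact hK.trans (le_mul_of_one_le_right (by positivity) hψ)
      -- At distances up to `h` the Lipschitz bound of the weights applies, with h^γ (t/h) ≤ t^γ. At
      -- larger distances the error h^γ at each point is already at most t^γ.
      rcases le_or_gt ‖y - z‖ h with hyz | hyz
      · refine le_trans ?_ (hgoal K₂ hK₂0.le (by linarith))
        have := hw.abs_sum_mul_sub_sum_mul_le hx hc hC₂ hp hh hh₀ hd hβ0 hf hM hs hsm le_rfl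
          hy hz hyz
        rw [← hγ, add_sub_cancel_left] at this
        refine this.trans ?_
        rw [mul_assoc (K₂ * M)]
        gcongr
        have ht1 : ‖y - z‖ / h ≤ 1 := (div_le_one hh0).2 hyz
        calc h ^ γ * (‖y - z‖ / h) ≤ h ^ γ * (‖y - z‖ / h) ^ γ := by
              gcongr
              exact Real.self_le_rpow_of_le_one (by positivity) ht1 hγ1
          _ = ‖y - z‖ ^ γ := by
              rw [← Real.mul_rpow hh0.le (by positivity), mul_div_cancel₀ _ hh0.ne']
      · refine le_trans ?_ (hgoal (d + 2 * K₁) (by positivity) (by linarith))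
        have h1 := key1 y hy
        have h2 := key1 z hz
        have h3 : |partialDeriv s f y - partialDeriv s f z| ≤ d * M * ‖y - z‖ ^ γ := by
          have := hf.abs_partialDeriv_sub_le_min hβ0 hd hM hs (multiListing s) hy hz
          rwa [multiCount_multiListing] at this
        have h4 : h ^ γ ≤ ‖y - z‖ ^ γ := Real.rpow_le_rpow hh0.le hyz.le hγ0.le
        have h5 : K₁ * M * h ^ γ ≤ K₁ * M * ‖y - z‖ ^ γ := by gcongr
        rw [abs_le] at h1 h2 h3 ⊢
        constructor <;> nlinarith
  · have hsβ : β ≤ multiLength s := by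
      by_contra hcon
      exact absurd ((le_strictFloor_iff hβ0 _).2 (not_le.1 hcon)) (not_le.2 hs)
    set b := strictFloor β with hb
    have hbβ : (b : ℝ) + min 1 (β - b) = β := by
      rw [min_eq_right (by have := le_strictFloor_add_one (α := β); linarith)]
      ring
    -- Here ∂^s f need not exist and the smoothed function is of order h^(β-|s|). The surplus
    -- h^(β-β₁) over h^(β₁-|s|) is spent on a positive Hölder exponent, which requires β₁ < β.
    set θ := min 1 (β - β₁) with hθ
    have hθ0 : 0 < θ := lt_min one_pos (by linarith)
    have hθ1 : θ ≤ 1 := min_le_left _ _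
    have hθβ : θ ≤ β - β₁ := min_le_right _ _
    set K₁ := Cd * Γ ^ d * C₁ * d ^ (b + 1) with hK₁
    set K₂ := Cd * Γ ^ d * 2 ^ d * C₂ * d ^ (b + 1) * (2 : ℝ) ^ β with hK₂
    have hK₁0 : 0 < K₁ := by positivity
    have hK₂0 : 0 < K₂ := by positivity
    refine ⟨θ, hθ0, 2 * K₁ + K₂, by positivity, ?_⟩
    intro p x m h₀ h w hx hsm hw hp hh hh₀ hh1 M f hf hM
    have hh0 : 0 < h := lt_of_le_of_lt (by positivity) hh
    rw [min_eq_right (by linarith : β₁ ≤ multiLength s)]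
    have hsplit : h ^ (β - (multiLength s : ℝ)) = h ^ (β₁ - (multiLength s : ℝ)) * h ^ (β - β₁) := by
      rw [← Real.rpow_add hh0]; congr 1; ring
    have hhθ : h ^ (β - β₁) ≤ h ^ θ := Real.rpow_le_rpow_of_exponent_ge hh0 hh1 hθβ
    have hhθ1 : h ^ θ ≤ 1 := Real.rpow_le_one hh0.le hh1 hθ0.le
    have key1 : ∀ y ∈ unitCube d, |∑ j, w h y j * f (gridPoint x j)| ≤
        K₁ * M * h ^ (β₁ - (multiLength s : ℝ)) * h ^ θ := by
      intro y hy
      have := hw.abs_sum_mul_sub_le hx hc hC₁ hp hh hh₀ hd hβ0 hf hM le_rfl (by omega) hy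
      rw [if_neg (by omega), sub_zero, hbβ, hsplit, ← mul_assoc] at this
      refine this.trans ?_
      gcongr
    refine ⟨fun y hy => (key1 y hy).trans ?_, fun y hy z hz => ?_⟩
    · calc K₁ * M * h ^ (β₁ - (multiLength s : ℝ)) * h ^ θ
          ≤ K₁ * M * h ^ (β₁ - (multiLength s : ℝ)) := mul_le_of_le_one_right (by positivity) hhθ1
        _ = K₁ * h ^ (β₁ - (multiLength s : ℝ)) * M := by ring
        _ ≤ (2 * K₁ + K₂) * h ^ (β₁ - (multiLength s : ℝ)) * M := by gcongr; linarith
    · rcases le_or_gt ‖y - z‖ h with hyz | hyz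
      · have := hw.abs_sum_mul_sub_sum_mul_le hx hc hC₂ hp hh hh₀ hd hβ0 hf hM le_rfl
          (by omega) hs.le hy hz hyz
        rw [hbβ, hsplit] at this
        refine this.trans ?_
        have ht1 : ‖y - z‖ / h ≤ 1 := (div_le_one hh0).2 hyz
        calc K₂ * M * (h ^ (β₁ - (multiLength s : ℝ)) * h ^ (β - β₁)) * (‖y - z‖ / h)
            ≤ K₂ * M * (h ^ (β₁ - (multiLength s : ℝ)) * h ^ θ) * (‖y - z‖ / h) ^ θ := by
              gcongr
              exact Real.self_le_rpow_of_le_one (by positivity) ht1 hθ1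
          _ = K₂ * h ^ (β₁ - (multiLength s : ℝ)) * M * (h ^ θ * (‖y - z‖ / h) ^ θ) := by ring
          _ = K₂ * h ^ (β₁ - (multiLength s : ℝ)) * M * ‖y - z‖ ^ θ := by
              rw [← Real.mul_rpow hh0.le (by positivity), mul_div_cancel₀ _ hh0.ne']
          _ ≤ (2 * K₁ + K₂) * h ^ (β₁ - (multiLength s : ℝ)) * M * ‖y - z‖ ^ θ := by
              gcongr; linarith
      · have h1 := key1 y hy
        have h2 := key1 z hz
        have h4 : h ^ θ ≤ ‖y - z‖ ^ θ := Real.rpow_le_rpow hh0.le hyz.le hθ0.le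
        refine (abs_sub _ _).trans ?_
        calc _ ≤ K₁ * M * h ^ (β₁ - (multiLength s : ℝ)) * h ^ θ +
              K₁ * M * h ^ (β₁ - (multiLength s : ℝ)) * h ^ θ := add_le_add h1 h2
          _ = 2 * K₁ * h ^ (β₁ - (multiLength s : ℝ)) * M * h ^ θ := by ring
          _ ≤ (2 * K₁ + K₂) * h ^ (β₁ - (multiLength s : ℝ)) * M * ‖y - z‖ ^ θ := by
              gcongr; linarith

end HolderProcess

/-! ### The noise term -/

section ErrorTerm

theorem ProbabilityTheory.HasSubgaussianMGF.mono_real {Ω : Type*} [MeasurableSpace Ω]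
    {P : Measure Ω} {X : Ω → ℝ} {v v' : ℝ≥0} (hX : HasSubgaussianMGF X v P) (h : v ≤ v') :
    HasSubgaussianMGF X v' P :=
  ⟨hX.integrable_exp_mul, fun t => (hX.mgf_le t).trans (by gcongr)⟩

/-- A weighted sum of the averaged errors is sub-Gaussian. -/
theorem FunctionalNoise.hasSubgaussianMGF_sum {d n : ℕ} {p : Fin d → ℕ} {Ω : Type*}
    [MeasurableSpace Ω] {P : Measure Ω} {β CZ ζ σ : ℝ}
    {Z : Fin n → Ω → (Fin d → ℝ) → ℝ} {ε : Fin n → GridIndex p → Ω → ℝ}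
    (hN : FunctionalNoise P β CZ ζ σ Z ε) (u : GridIndex p → ℝ) {q : ℝ}
    (hu : ∑ j, u j ^ 2 ≤ q) :
    HasSubgaussianMGF (fun ω => ∑ j, u j * (1 / (n : ℝ) * ∑ i, ε i j ω))
      (Real.toNNReal (ζ ^ 2 * σ ^ 2 * (q / n))) P := by
  have h1 : ∀ a : Fin n × GridIndex p, HasSubgaussianMGF (fun ω => (u a.2 / n) * ε a.1 a.2 ω)
      (Real.toNNReal ((u a.2 / n) ^ 2 * (ζ ^ 2 * σ ^ 2))) P := fun a => by
    refine (((hN.error_subGaussian a.1 a.2).mono_real (Real.toNNReal_le_toNNReal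
      (mul_le_mul_of_nonneg_left (hN.error_variance_le a.1 a.2) (sq_nonneg ζ)))).const_mul
        (u a.2 / n)).mono_real ?_
    rw [← NNReal.coe_le_coe]
    refine (le_of_eq (NNReal.coe_mul _ _)).trans ?_
    rw [Real.coe_toNNReal _ (by positivity), Real.coe_toNNReal _ (by positivity)]
    exact le_rfl
  have hind : iIndepFun (fun (a : Fin n × GridIndex p) ω => (u a.2 / n) * ε a.1 a.2 ω) P :=
    hN.error_indep.comp (fun a t => (u a.2 / n) * t) fun a => measurable_id.const_mul _
  have h2 := HasSubgaussianMGF.sum_of_iIndepFun hind (s := Finset.univ) fun a _ => h1 a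
  have h3 : (fun ω => ∑ a : Fin n × GridIndex p, (u a.2 / n) * ε a.1 a.2 ω) =
      fun ω => ∑ j, u j * (1 / (n : ℝ) * ∑ i, ε i j ω) := by
    funext ω
    rw [Fintype.sum_prod_type, Finset.sum_comm]
    refine Finset.sum_congr rfl fun j _ => ?_
    simp only [Finset.mul_sum]
    refine Finset.sum_congr rfl fun i _ => ?_
    ring
  rw [h3] at h2
  refine h2.mono_real ?_
  rw [← NNReal.coe_le_coe, NNReal.coe_sum]
  simp only [fun a : Fin n × GridIndex p => Real.coe_toNNReal
    ((u a.2 / n) ^ 2 * (ζ ^ 2 * σ ^ 2)) (by positivity)]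
  rw [← Finset.sum_mul, mul_comm]
  refine le_trans ?_ (Real.le_coe_toNNReal _)
  gcongr
  simp only [Fintype.sum_prod_type, div_pow, ← Finset.sum_div]
  rw [Finset.sum_const, Finset.card_univ, Fintype.card_fin, nsmul_eq_mul]
  rcases Nat.eq_zero_or_pos n with rfl | hn
  · simp
  · have hn' : (0 : ℝ) < n := by exact_mod_cast hn
    calc (n : ℝ) * (∑ j, u j ^ 2) / n ^ 2 = (∑ j, u j ^ 2) / n := by field_simp
      _ ≤ q / n := by gcongr

theorem cubeSupNorm_le_of_lipschitz {d : ℕ} {K : ℕ} (hK : 0 < K) {g : (Fin d → ℝ) → ℝ} {A : ℝ}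
    (hA : 0 ≤ A)
    (hg : ∀ y ∈ unitCube d, ∀ z ∈ unitCube d, |g y - g z| ≤ A * ‖y - z‖) :
    cubeSupNorm g ≤ (⨆ e : Fin d → Fin (K + 1), ENNReal.ofReal |g (gridNode K e)|) +
      ENNReal.ofReal (A * (1 / K)) := by
  refine iSup₂_le fun y hy => ?_
  refine le_trans ?_ (add_le_add
    (le_iSup (fun e : Fin d → Fin (K + 1) => ENNReal.ofReal |g (gridNode K e)|) (floorIndex K y))
    le_rfl)
  rw [← ENNReal.ofReal_add (abs_nonneg _) (by positivity)]
  refine ENNReal.ofReal_le_ofReal ?_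
  have h1 := hg y hy _ (gridNode_mem_unitCube (floorIndex K y))
  have h2 := abs_add_le (g (gridNode K (floorIndex K y)))
    (g y - g (gridNode K (floorIndex K y)))
  rw [add_sub_cancel] at h2
  have h3 : A * ‖y - gridNode K (floorIndex K y)‖ ≤ A * (1 / K) := by
    gcongr
    exact norm_sub_gridNode_floorIndex_le hK hy
  linarith

theorem log_two_mul_card_le {d N : ℕ} (hN : 3 ≤ N) :
    Real.log (2 * Fintype.card (Fin d → Fin (N ^ 2 + 1))) ≤ (3 * d + 1) * Real.log N := by
  have hN' : (3 : ℝ) ≤ N := by exact_mod_cast hN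
  have h1 : 2 * (Fintype.card (Fin d → Fin (N ^ 2 + 1)) : ℝ) ≤ (N : ℝ) ^ (3 * d + 1) := by
    rw [Fintype.card_pi]
    simp only [Fintype.card_fin, Finset.prod_const, Finset.card_univ]
    rw [pow_succ (N : ℝ) (3 * d), pow_mul, mul_comm]
    push_cast
    gcongr
    · nlinarith [sq_nonneg (N : ℝ)]
    · linarith
  refine (Real.log_le_log (by positivity) h1).trans (le_of_eq ?_)
  rw [Real.log_pow]
  push_cast
  ring

/-- A measurable bound of the maximum of the error term, with the logarithm of the number of design points in place of
the logarithm of the inverse bandwidth. -/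
theorem exists_lintegral_error_le {d : ℕ} (hd : 0 < d) {c C₁ C₂ Cd : ℝ} (hc : 0 < c)
    (hC₁ : 0 < C₁) (hC₂ : 0 < C₂) (hCd : 0 < Cd) (s : Fin d → ℕ) :
    ∃ C : ℝ, 0 < C ∧ ∀ {n : ℕ} {p : Fin d → ℕ} {x : (k : Fin d) → Fin (p k) → ℝ} {m : ℕ}
      {h₀ h : ℝ} {w : ℝ → (Fin d → ℝ) → GridIndex p → ℝ}, RegularDesign Cd x →
      WeightConditions x s m c h₀ C₁ C₂ w → 0 < n → 3 ≤ pMin p →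
      c / pMin p < h → h ≤ h₀ → h ≤ 1 →
      ∀ {Ω : Type*} [MeasurableSpace Ω] {P : Measure Ω} [IsProbabilityMeasure P] {β CZ ζ σ : ℝ}
        {Z : Fin n → Ω → (Fin d → ℝ) → ℝ} {ε : Fin n → GridIndex p → Ω → ℝ}, 0 < ζ → 0 ≤ σ →
      FunctionalNoise P β CZ ζ σ Z ε →
      ∃ F : Ω → ℝ≥0∞, Measurable F ∧
        (∀ ω, cubeSupNorm (fun y => ∑ j, w h y j * (1 / (n : ℝ) * ∑ i, ε i j ω)) ≤ F ω) ∧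
        ∫⁻ ω, F ω ∂P ≤ ENNReal.ofReal (C * (ζ * σ *
          √(Real.log (gridSize p) / (n * gridSize p * h ^ (d + 2 * multiLength s))))) := by
  set Γ := max 1 (1 / c) with hΓ
  have hΓ0 : 0 < Γ := lt_of_lt_of_le one_pos (le_max_left _ _)
  set Q := Cd * Γ ^ d * C₁ ^ 2 with hQ
  have hQ0 : 0 < Q := by positivity
  refine ⟨√(2 * Q * (3 * d + 1)) + C₂ / c * √(2 * Real.log 2) * √(1 / c ^ d), by positivity, ?_⟩
  intro n p x m h₀ h w hx hw hn hpm hh hh₀ hh1 Ω _ P _ β CZ ζ σ Z ε hζ hσ hN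
  have hh0 : 0 < h := lt_of_le_of_lt (by positivity) hh
  have hpN : 3 ≤ gridSize p := hpm.trans (pMin_le_gridSize hd)
  set N := gridSize p with hNdef
  have hN0 : (0 : ℝ) < N := by exact_mod_cast (by omega : 0 < N)
  have hn0 : (0 : ℝ) < n := by exact_mod_cast hn
  have hpm0 : (0 : ℝ) < pMin p := by exact_mod_cast (by omega : 0 < pMin p)
  set ℓ := Real.log N with hℓ
  have hℓ1 : 1 ≤ ℓ := by
    rw [hℓ, Real.le_log_iff_exp_le hN0]
    have : (3 : ℝ) ≤ N := by exact_mod_cast hpN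
    linarith [Real.exp_one_lt_d9]
  set k := multiLength s with hk
  set D := n * N * h ^ (d + 2 * k) with hD
  have hD0 : 0 < D := by positivity
  have hch : c ≤ pMin p * h := by
    rw [div_lt_iff₀ hpm0] at hh; linarith
  have hNh : c ^ d ≤ N * h ^ d := by
    calc c ^ d ≤ (pMin p * h) ^ d := by gcongr
      _ = (pMin p : ℝ) ^ d * h ^ d := mul_pow _ _ _
      _ ≤ N * h ^ d := by
        gcongr
        exact_mod_cast pMin_pow_le_gridSize
  have hNh1 : c ≤ N * h := hch.trans (by
    gcongr
    exact_mod_cast pMin_le_gridSize hd)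
  set e : Ω → (Fin d → ℝ) → ℝ := fun ω y => ∑ j, w h y j * (1 / (n : ℝ) * ∑ i, ε i j ω) with he
  -- O(N h^d) nonzero weights, each of square O(1 / (N h^(d+k))²).
  have hvar : ∀ y ∈ unitCube d, ∑ j, w h y j ^ 2 ≤ Q / (N * h ^ (d + 2 * k)) := by
    intro y hy
    have h1 := hx.abs_sum_mul_le hc hh le_rfl hy (u := w h y) (g := w h y)
      (b := C₁ / (N * h ^ (d + k))) (g₀ := C₁ / (N * h ^ (d + k))) (by positivity) (by positivity)
      (hw.localize h hh hh₀ y hy) (hw.bounded h hh hh₀ y hy)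
      (fun j _ => hw.bounded h hh hh₀ y hy j)
    simp only [← sq] at h1
    refine (le_abs_self _).trans (h1.trans (le_of_eq ?_))
    rw [hQ, ← hΓ, ← hNdef, mul_pow, pow_add, pow_add, pow_mul']
    field_simp
  have hsub : ∀ y ∈ unitCube d, HasSubgaussianMGF (fun ω => e ω y)
      (Real.toNNReal (ζ ^ 2 * σ ^ 2 * (Q / D))) P := by
    intro y hy
    have := hN.hasSubgaussianMGF_sum (w h y) (hvar y hy)
    have h2 : Q / (N * h ^ (d + 2 * k)) / n = Q / D := by
      rw [hD, div_div]; congr 1; ring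
    rwa [h2] at this
  have hmean : ∀ j : GridIndex p, ∫⁻ ω, ENNReal.ofReal |1 / (n : ℝ) * ∑ i, ε i j ω| ∂P ≤
      ENNReal.ofReal (ζ * σ * √(2 * Real.log 2) * √(1 / n)) := by
    intro j
    have h1 := hN.hasSubgaussianMGF_sum (fun j' => if j' = j then 1 else 0) (q := 1) (by simp)
    simp only [ite_mul, one_mul, zero_mul, Finset.sum_ite_eq', Finset.mem_univ, if_true] at h1
    have h2 := lintegral_iSup_abs_le_of_subgaussian (κ := Unit) fun _ => h1
    simp only [ciSup_const, Fintype.card_unit, Nat.cast_one, mul_one] at h2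
    rw [Real.coe_toNNReal _ (by positivity)] at h2
    refine h2.trans (ENNReal.ofReal_le_ofReal (le_of_eq ?_))
    rw [show 2 * (ζ ^ 2 * σ ^ 2 * (1 / n)) * Real.log 2 =
      (ζ * σ) ^ 2 * (2 * Real.log 2 * (1 / n)) by ring, Real.sqrt_mul (by positivity),
      Real.sqrt_sq (by positivity), Real.sqrt_mul (by positivity), ← mul_assoc]
  -- Mesh N^(-2) is fine enough for the crude Lipschitz constant with the sum of all |averaged
  -- errors|: that sum has N terms, the constant has an extra 1/h, and N h ≥ c. The logarithm of the
  -- number of nodes remains of order log N.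
  have hpt : ∀ ω, cubeSupNorm (e ω) ≤
      (⨆ a : Fin d → Fin (N ^ 2 + 1), ENNReal.ofReal |e ω (gridNode (N ^ 2) a)|) +
        ∑ j, ENNReal.ofReal (C₂ / (N * h ^ (d + k)) / h * (1 / (N ^ 2 : ℕ))) *
          ENNReal.ofReal |1 / (n : ℝ) * ∑ i, ε i j ω| := by
    intro ω
    have h1 := cubeSupNorm_le_of_lipschitz (d := d) (K := N ^ 2) (by positivity) (g := e ω)
      (A := C₂ / (N * h ^ (d + k)) / h * ∑ j, |1 / (n : ℝ) * ∑ i, ε i j ω|)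
      (by positivity) (fun y hy z hz => by
        simp only [he]
        rw [← Finset.sum_sub_distrib, Finset.mul_sum, Finset.sum_mul]
        refine (Finset.abs_sum_le_sum_abs _ _).trans (Finset.sum_le_sum fun j _ => ?_)
        rw [← sub_mul, abs_mul, mul_right_comm]
        refine mul_le_mul_of_nonneg_right ?_ (abs_nonneg _)
        refine (hw.lipschitz h hh hh₀ y hy z hz j).trans ?_
        rw [div_mul_eq_mul_div (C₂ / _), mul_div_assoc]
        gcongr
        exact min_le_left _ _)
    refine h1.trans (add_le_add le_rfl (le_of_eq ?_))
    rw [mul_right_comm, Finset.mul_sum, ENNReal.ofReal_sum_of_nonneg fun j _ => by positivity]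
    exact Finset.sum_congr rfl fun j _ => ENNReal.ofReal_mul (by positivity)
  have hemeas : ∀ y, Measurable fun ω => e ω y := fun y =>
    Finset.measurable_sum _ fun j _ => ((Finset.measurable_sum _ fun i _ =>
      hN.error_measurable i j).const_mul _).const_mul _
  have hjm : ∀ j : GridIndex p, Measurable fun ω =>
      ENNReal.ofReal |1 / (n : ℝ) * ∑ i, ε i j ω| := fun j =>
    ((Finset.measurable_sum _ fun i _ => hN.error_measurable i j).const_mul _).abs.ennreal_ofReal
  -- The majorant involves finitely many nodes and errors, so it is measurable without any argument
  -- about the supremum over the cube.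
  refine ⟨_, (Measurable.iSup fun a => (hemeas _).abs.ennreal_ofReal).add
    (Finset.measurable_sum _ fun j _ => (hjm j).const_mul _), hpt, ?_⟩
  simp only [Pi.add_apply]
  rw [lintegral_add_left (Measurable.iSup fun a => (hemeas _).abs.ennreal_ofReal),
    lintegral_finsetSum _ fun j _ => (hjm j).const_mul _]
  simp only [fun j => lintegral_const_mul (μ := P)
    (ENNReal.ofReal (C₂ / (N * h ^ (d + k)) / h * (1 / (N ^ 2 : ℕ)))) (hjm j)]
  have hA := lintegral_iSup_abs_le_of_subgaussian (P := P)
    fun a : Fin d → Fin (N ^ 2 + 1) => hsub _ (gridNode_mem_unitCube a)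
  rw [Real.coe_toNNReal _ (by positivity)] at hA
  have hA' : √(2 * (ζ ^ 2 * σ ^ 2 * (Q / D)) *
      Real.log (2 * Fintype.card (Fin d → Fin (N ^ 2 + 1)))) ≤
      √(2 * Q * (3 * d + 1)) * (ζ * σ * √(ℓ / D)) := by
    calc _ ≤ √((ζ * σ) ^ 2 * ((2 * Q * (3 * d + 1)) * (ℓ / D))) := by
          refine Real.sqrt_le_sqrt ?_
          calc _ ≤ 2 * (ζ ^ 2 * σ ^ 2 * (Q / D)) * ((3 * d + 1) * ℓ) := by
                gcongr
                exact log_two_mul_card_le hpN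
            _ = _ := by ring
      _ = _ := by
          rw [Real.sqrt_mul (by positivity), Real.sqrt_sq (by positivity),
            Real.sqrt_mul (by positivity)]
          ring
  have hcard : (Fintype.card (GridIndex p) : ℝ) = N := by
    rw [hNdef, gridSize, Fintype.card_pi]
    simp
  have hB : ∑ j : GridIndex p, ENNReal.ofReal (C₂ / (N * h ^ (d + k)) / h * (1 / (N ^ 2 : ℕ))) *
      ∫⁻ ω, ENNReal.ofReal |1 / (n : ℝ) * ∑ i, ε i j ω| ∂P ≤
      ENNReal.ofReal (C₂ / c * √(2 * Real.log 2) * √(1 / c ^ d) * (ζ * σ * √(ℓ / D))) := by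
    refine (Finset.sum_le_sum fun j _ => mul_le_mul_right (hmean j) _).trans ?_
    rw [Finset.sum_const, Finset.card_univ, nsmul_eq_mul, ← ENNReal.ofReal_natCast, hcard,
      ← ENNReal.ofReal_mul (by positivity), ← ENNReal.ofReal_mul (by positivity)]
    refine ENNReal.ofReal_le_ofReal ?_
    have e1 : √(1 / (n : ℝ)) * (1 / (N * h ^ (d + k))) ≤ √(1 / c ^ d) * √(ℓ / D) := by
      rw [← Real.sqrt_mul (by positivity), ← Real.sqrt_sq (by positivity : 0 ≤ 1 / (N * h ^ (d + k))),
        ← Real.sqrt_mul (by positivity)]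
      refine Real.sqrt_le_sqrt ?_
      have e2 : 1 / (n : ℝ) * (1 / (N * h ^ (d + k))) ^ 2 = 1 / (N * h ^ d) * (1 / D) := by
        rw [hD, pow_add, pow_add, pow_mul']
        field_simp
      rw [e2]
      gcongr
    have e3 : (N : ℝ) * (1 / h * (1 / (N ^ 2 : ℕ))) ≤ 1 / c := by
      have : (N : ℝ) * (1 / h * (1 / (N ^ 2 : ℕ))) = 1 / (N * h) := by
        push_cast
        field_simp
      rw [this]
      gcongr
    calc _ = C₂ * √(2 * Real.log 2) * (ζ * σ) * ((N : ℝ) * (1 / h * (1 / (N ^ 2 : ℕ)))) *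
          (√(1 / (n : ℝ)) * (1 / (N * h ^ (d + k)))) := by ring
      _ ≤ C₂ * √(2 * Real.log 2) * (ζ * σ) * (1 / c) * (√(1 / c ^ d) * √(ℓ / D)) := by gcongr
      _ = _ := by ring
  rw [add_mul, ENNReal.ofReal_add (by positivity) (by positivity)]
  exact add_le_add (hA.trans (ENNReal.ofReal_le_ofReal hA')) hB

/-- The logarithm of the number of design points can be replaced by that of the inverse bandwidth:
for large bandwidths the bias dominates. -/
theorem error_rate_le {α L ζ σ h : ℝ} {d k n N : ℕ} (hα : 0 < α) (hL : 0 < L) (hζ : 0 < ζ)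
    (hσ : 0 ≤ σ) (hh : 0 < h) (hn : 0 < n) (hN : 0 < N) :
    ζ * σ * √(Real.log N / (n * N * h ^ (d + 2 * k))) ≤
      (√(2 * (2 * α + d)) + √2 * ζ * σ / L) * max (L * h ^ (α - (k : ℝ)))
        (ζ * σ * √(Real.log h⁻¹ / (n * N * h ^ (d + 2 * k)))) := by
  have hn1 : (1 : ℝ) ≤ n := by exact_mod_cast hn
  have hN1 : (1 : ℝ) ≤ N := by exact_mod_cast hN
  have hN0 : (0 : ℝ) < N := by linarith
  -- Chosen such that log N > δ log h⁻¹ implies h^(-(2α+d)) ≤ N^(1/2). One factor N^(1/2) then pays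
  -- for the power of `h` and the other for log N. This case covers h = 1 with N > 1, where log h⁻¹
  -- vanishes.
  set δ := 2 * (2 * α + d) with hδ
  have hδ0 : 0 < δ := by positivity
  set A := L * h ^ (α - (k : ℝ)) with hA
  set B := ζ * σ * √(Real.log h⁻¹ / (n * N * h ^ (d + 2 * k))) with hB
  have hA0 : 0 ≤ A := by positivity
  have hB0 : 0 ≤ B := by positivity
  rw [add_mul]
  rcases le_or_gt (Real.log N) (δ * Real.log h⁻¹) with hcase | hcase
  · refine le_add_of_le_of_nonneg ?_ (by positivity)
    calc ζ * σ * √(Real.log N / (n * N * h ^ (d + 2 * k)))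
        ≤ ζ * σ * √(δ * (Real.log h⁻¹ / (n * N * h ^ (d + 2 * k)))) := by
          gcongr
          rw [← mul_div_assoc]
          gcongr
      _ = √δ * B := by rw [Real.sqrt_mul hδ0.le, hB]; ring
      _ ≤ √δ * max A B := by gcongr; exact le_max_right _ _
  · refine le_add_of_nonneg_of_le (by positivity) ?_
    have h1 : (h ^ (2 * α + d))⁻¹ ≤ (N : ℝ) ^ (1 / 2 : ℝ) := by
      rw [← Real.log_le_log_iff (by positivity) (by positivity), Real.log_inv,
        Real.log_rpow hh, Real.log_rpow hN0]
      rw [Real.log_inv] at hcase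
      rw [hδ] at hcase
      nlinarith
    have h2 : Real.log N ≤ 2 * (N : ℝ) ^ (1 / 2 : ℝ) := by
      have := Real.log_le_rpow_div hN0.le (by norm_num : (0 : ℝ) < 1 / 2)
      linarith
    have h3 : (N : ℝ) ^ (1 / 2 : ℝ) * (N : ℝ) ^ (1 / 2 : ℝ) = N := by
      rw [← Real.rpow_add hN0]; norm_num
    have h4 : (h ^ (α - (k : ℝ))) ^ 2 * (h ^ (2 * α + d))⁻¹ = (h ^ (d + 2 * k))⁻¹ := by
      rw [← Real.rpow_natCast, ← Real.rpow_natCast, ← Real.rpow_neg hh.le, ← Real.rpow_neg hh.le,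
        ← Real.rpow_mul hh.le, ← Real.rpow_add hh]
      congr 1
      push_cast
      ring
    have h5 : Real.log N / (n * N * h ^ (d + 2 * k)) ≤ 2 * (h ^ (α - (k : ℝ))) ^ 2 := by
      have hlog : 0 ≤ Real.log N := Real.log_nonneg hN1
      calc Real.log N / (n * N * h ^ (d + 2 * k)) ≤ Real.log N / (1 * N * h ^ (d + 2 * k)) := by
            gcongr
        _ = Real.log N / N * (h ^ (d + 2 * k))⁻¹ := by field_simp
        _ = Real.log N / N * ((h ^ (α - (k : ℝ))) ^ 2 * (h ^ (2 * α + d))⁻¹) := by rw [h4]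
        _ ≤ (2 * (N : ℝ) ^ (1 / 2 : ℝ)) / N * ((h ^ (α - (k : ℝ))) ^ 2 * (N : ℝ) ^ (1 / 2 : ℝ)) := by
            gcongr
        _ = 2 * (h ^ (α - (k : ℝ))) ^ 2 *
              (((N : ℝ) ^ (1 / 2 : ℝ) * (N : ℝ) ^ (1 / 2 : ℝ)) / N) := by ring
        _ = 2 * (h ^ (α - (k : ℝ))) ^ 2 := by rw [h3, div_self hN0.ne', mul_one]
    calc ζ * σ * √(Real.log N / (n * N * h ^ (d + 2 * k)))
        ≤ ζ * σ * √(2 * (h ^ (α - (k : ℝ))) ^ 2) := by gcongr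
      _ = √2 * ζ * σ / L * A := by
          rw [Real.sqrt_mul two_pos.le, Real.sqrt_sq (by positivity), hA]
          field_simp
      _ ≤ √2 * ζ * σ / L * max A B := by gcongr; exact le_max_left _ _

end ErrorTerm

/-! ### The process term -/

section ProcessTerm

/-- The process term of the estimator. -/
theorem exists_lintegral_process_le {d : ℕ} (hd : 0 < d) {β β₁ CZ c C₁ C₂ Cd : ℝ} (hβ₁ : 0 < β₁)
    (hβ : β₁ < β) (hCZ : 0 < CZ) (hc : 0 < c) (hC₁ : 0 < C₁) (hC₂ : 0 < C₂) (hCd : 0 < Cd)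
    (s : Fin d → ℕ) :
    ∃ C : ℝ, 0 < C ∧ ∀ {n : ℕ} {p : Fin d → ℕ} {x : (k : Fin d) → Fin (p k) → ℝ} {m : ℕ}
      {h₀ h : ℝ} {w : ℝ → (Fin d → ℝ) → GridIndex p → ℝ}, RegularDesign Cd x →
      multiLength s ≤ m → WeightConditions x s m c h₀ C₁ C₂ w → 0 < n → 0 < gridSize p →
      c / pMin p < h → h ≤ h₀ → h ≤ 1 →
      ∀ {Ω : Type*} [MeasurableSpace Ω] {P : Measure Ω} [IsProbabilityMeasure P] {ζ σ : ℝ}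
        {Z : Fin n → Ω → (Fin d → ℝ) → ℝ} {ε : Fin n → GridIndex p → Ω → ℝ},
      FunctionalNoise P β CZ ζ σ Z ε →
      ∫⁻ ω, ENNReal.ofReal (1 / n) *
          cubeSupNorm (fun y => ∑ i, ∑ j, w h y j * Z i ω (gridPoint x j)) ∂P ≤
        ENNReal.ofReal (C *
          (CZ / (√n * h ^ ((multiLength s : ℝ) - min (multiLength s : ℝ) β₁)))) := by
  obtain ⟨θ, hθ, K, hK, hbound⟩ := exists_holder_bound_sum_mul hd hβ₁ hβ hc hC₁ hC₂ hCd s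
  obtain ⟨C, hC, hchain⟩ := exists_lintegral_cubeSupNorm_sum_le d hθ
  -- Second moments produce √CZ, whereas the rate contains CZ; the quotient goes into the constant.
  refine ⟨C * K * √CZ / CZ, by positivity, ?_⟩
  intro n p x m h₀ h w hx hsm hw hn hp hh hh₀ hh1 Ω _ P _ ζ σ Z ε hN
  have hh0 : 0 < h := lt_of_le_of_lt (by positivity) hh
  have hn0 : (0 : ℝ) < n := by exact_mod_cast hn
  choose hZm M hM hMCZ hMZ using hN.process_mem
  set ψ := h ^ (min (multiLength s : ℝ) β₁ - multiLength s) with hψ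
  have hψ0 : 0 < ψ := Real.rpow_pos_of_pos hh0 _
  have hZi : ∀ i, ∀ z ∈ unitCube d, Integrable (fun ω => Z i ω z) P := by
    intro i z hz
    refine ((hM i).integrable one_le_two).abs.mono' (hZm i z hz).aestronglyMeasurable ?_
    filter_upwards [hMZ i] with ω hω
    have h0 := (hω.mono (le_abs_self _)).abs_partialDeriv_le (abs_nonneg (M i ω)) (r := 0)
      (by simp [multiLength]) hz
    have h1 : partialDeriv 0 (Z i ω) z = Z i ω z := by
      have := iteratedFDerivWithin_single_eq_partialDeriv (k := 0) (f := Z i ω)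
        (hω.1.of_le (by simp)) hz (fun l => l.elim0)
      have h2 : multiCount (fun l : Fin 0 => (l.elim0 : Fin d)) = 0 := by
        funext i; simp [multiCount]
      rw [← h2, ← this, iteratedFDerivWithin_zero_apply]
    rwa [h1] at h0
  -- Chaining is applied to the smoothed paths, with the Hölder bound of each path as envelope; |M|
  -- is used because the sign of M is not prescribed.
  have hmain := hchain P (fun i ω y => ∑ j, w h y j * Z i ω (gridPoint x j))
    (fun i ω => K * ψ * |M i ω|)
    (fun i y _ => Finset.measurable_sum _ fun j _ =>
      (hZm i _ (hx.gridPoint_mem j)).const_mul _)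
    (hN.process_indep.comp
      (fun _ g (y : unitCube d) => ∑ j, w h y j * g ⟨gridPoint x j, hx.gridPoint_mem j⟩)
      fun _ => measurable_pi_lambda _ fun y => Finset.measurable_sum _ fun j _ =>
        (measurable_pi_apply _).const_mul _)
    (fun i y _ => by
      rw [integral_finsetSum _ fun j _ => (hZi i _ (hx.gridPoint_mem j)).const_mul _]
      refine Finset.sum_eq_zero fun j _ => ?_
      rw [integral_const_mul, hN.process_centered i _ (hx.gridPoint_mem j), mul_zero])
    (fun i => (hM i).abs.const_mul _) (fun i ω => by positivity)
    (fun i => (hMZ i).mono fun ω hω => (hbound hx hsm hw hp hh hh₀ hh1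
      (hω.mono (le_abs_self _)) (abs_nonneg _)).1)
    (fun i => (hMZ i).mono fun ω hω => (hbound hx hsm hw hp hh hh₀ hh1
      (hω.mono (le_abs_self _)) (abs_nonneg _)).2)
  rw [lintegral_const_mul' _ _ ENNReal.ofReal_ne_top]
  refine (mul_le_mul_right hmain _).trans ?_
  rw [← ENNReal.ofReal_mul (by positivity)]
  refine ENNReal.ofReal_le_ofReal ?_
  have h1 : ∑ i, ∫ ω, (K * ψ * |M i ω|) ^ 2 ∂P ≤ n * ((K * ψ) ^ 2 * CZ) := by
    have h2 : ∀ i ∈ Finset.univ, ∫ ω, (K * ψ * |M i ω|) ^ 2 ∂P ≤ (K * ψ) ^ 2 * CZ := by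
      intro i _
      simp only [mul_pow _ |M i _|, sq_abs, integral_const_mul]
      gcongr
      exact hMCZ i
    refine (Finset.sum_le_sum h2).trans (le_of_eq ?_)
    simp
  have h3 : √(n * ((K * ψ) ^ 2 * CZ)) = √n * (K * ψ * √CZ) := by
    rw [Real.sqrt_mul hn0.le, Real.sqrt_mul (sq_nonneg _), Real.sqrt_sq (by positivity)]
  have h4 : h ^ ((multiLength s : ℝ) - min (multiLength s : ℝ) β₁) = ψ⁻¹ := by
    rw [hψ, ← Real.rpow_neg hh0.le, neg_sub]
  calc 1 / n * (C * √(∑ i, ∫ ω, (K * ψ * |M i ω|) ^ 2 ∂P))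
      ≤ 1 / n * (C * (√n * (K * ψ * √CZ))) := by
        rw [← h3]; gcongr
    _ = (√n / n) * (C * K * ψ * √CZ) := by ring
    _ = (1 / √n) * (C * K * ψ * √CZ) := by rw [Real.sqrt_div_self, one_div]
    _ = C * K * √CZ / CZ * (CZ / (√n * ψ⁻¹)) := by field_simp
    _ = _ := by rw [h4]

end ProcessTerm

/-! ### Decomposition of the estimation error and conclusion -/

theorem cubeSupNorm_add_le {d : ℕ} (f g : (Fin d → ℝ) → ℝ) :
    cubeSupNorm (fun y => f y + g y) ≤ cubeSupNorm f + cubeSupNorm g := by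
  refine iSup₂_le fun y hy => ?_
  refine (ENNReal.ofReal_le_ofReal (abs_add_le _ _)).trans ?_
  rw [ENNReal.ofReal_add (abs_nonneg _) (abs_nonneg _)]
  exact add_le_add (le_iSup₂ (f := fun y (_ : y ∈ unitCube d) => ENNReal.ofReal |f y|) y hy)
    (le_iSup₂ (f := fun y (_ : y ∈ unitCube d) => ENNReal.ofReal |g y|) y hy)

theorem cubeSupNorm_const_mul_le {d : ℕ} {a : ℝ} (ha : 0 ≤ a) (f : (Fin d → ℝ) → ℝ) :
    cubeSupNorm (fun y => a * f y) ≤ ENNReal.ofReal a * cubeSupNorm f := by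
  refine iSup₂_le fun y hy => ?_
  rw [abs_mul, abs_of_nonneg ha, ENNReal.ofReal_mul ha]
  exact mul_le_mul_right (le_iSup₂ (f := fun y (_ : y ∈ unitCube d) => ENNReal.ofReal |f y|) y hy) _

theorem linearEstimator_observation_sub_eq {d n : ℕ} {p : Fin d → ℕ} {Ω : Type*} (hn : 0 < n)
    (x : (k : Fin d) → Fin (p k) → ℝ) (w : ℝ → (Fin d → ℝ) → GridIndex p → ℝ)
    (μ : (Fin d → ℝ) → ℝ) (Z : Fin n → Ω → (Fin d → ℝ) → ℝ) (ε : Fin n → GridIndex p → Ω → ℝ)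
    (h : ℝ) (y : Fin d → ℝ) (ω : Ω) (D : ℝ) :
    linearEstimator w (observation x μ Z ε) h y ω - D =
      (∑ j, w h y j * μ (gridPoint x j) - D) +
        (1 / (n : ℝ) * ∑ i, ∑ j, w h y j * Z i ω (gridPoint x j) +
          ∑ j, w h y j * (1 / (n : ℝ) * ∑ i, ε i j ω)) := by
  have hn0 : (n : ℝ) ≠ 0 := by exact_mod_cast hn.ne'
  have h1 : ∀ j, w h y j * (1 / (n : ℝ) * ∑ i, observation x μ Z ε i j ω) =
      w h y j * μ (gridPoint x j) + (1 / (n : ℝ) * ∑ i, w h y j * Z i ω (gridPoint x j) +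
        w h y j * (1 / (n : ℝ) * ∑ i, ε i j ω)) := by
    intro j
    simp only [observation, Finset.sum_add_distrib, ← Finset.mul_sum]
    rw [Finset.sum_const, Finset.card_univ, Fintype.card_fin, nsmul_eq_mul]
    field_simp
    ring
  rw [linearEstimator, Finset.sum_congr rfl fun j _ => h1 j, Finset.sum_add_distrib,
    Finset.sum_add_distrib, ← Finset.mul_sum, Finset.sum_comm]
  ring

theorem theorem1 {d : ℕ} (hd : 0 < d) (α β β₁ L CZ ζ σ c h₀ C₁ C₂ Cd : ℝ)
    (hα : 0 < α) (hβ₁ : 0 < β₁) (hβ : β₁ < β) (hL : 0 < L) (hCZ : 0 < CZ)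
    (hζ : 0 < ζ) (hσ : 0 ≤ σ) (hc : 0 < c) (hh₀ : 0 < h₀) (hh₀' : h₀ ≤ 1)
    (hC₁ : 0 < C₁) (hC₂ : 0 < C₂) (hCd : 0 < Cd)
    (s : Fin d → ℕ) (hs : multiLength s ≤ strictFloor α) :
    ∃ C : ℝ, 0 < C ∧ ∃ n₀ p₀ : ℕ, ∀ (n : ℕ) (p : Fin d → ℕ), n₀ ≤ n → p₀ ≤ pMin p →
      ∀ x : (k : Fin d) → Fin (p k) → ℝ, RegularDesign Cd x →
      ∀ w : ℝ → (Fin d → ℝ) → GridIndex p → ℝ,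
        WeightConditions x s (strictFloor α) c h₀ C₁ C₂ w →
      ∀ h : ℝ, c / pMin p < h → h ≤ h₀ →
      ∀ μ : (Fin d → ℝ) → ℝ, HolderClass α L μ →
      ∀ (Ω : Type*) [MeasurableSpace Ω] (P : Measure Ω) [IsProbabilityMeasure P]
        (Z : Fin n → Ω → (Fin d → ℝ) → ℝ) (ε : Fin n → GridIndex p → Ω → ℝ),
        FunctionalNoise P β CZ ζ σ Z ε →
        ∫⁻ ω, cubeSupNorm (fun y =>
            linearEstimator w (observation x μ Z ε) h y ω - partialDeriv s μ y) ∂P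
          ≤ ENNReal.ofReal (C * upperRate s α L ζ σ CZ β₁ n p h) := by
  obtain ⟨CP, hCP, hproc⟩ := exists_lintegral_process_le hd hβ₁ hβ hCZ hc hC₁ hC₂ hCd s
  obtain ⟨CE, hCE, herr⟩ := exists_lintegral_error_le hd hc hC₁ hC₂ hCd s
  set CR := √(2 * (2 * α + d)) + √2 * ζ * σ / L with hCR
  have hCR0 : 0 < CR := by positivity
  set CB := Cd * max 1 (1 / c) ^ d * C₁ * d ^ (strictFloor α + 1) with hCB
  have hCB0 : 0 < CB := by
    have : (0 : ℝ) < max 1 (1 / c) := lt_of_lt_of_le one_pos (le_max_left _ _)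
    positivity
  -- n ≥ 1 makes the averages meaningful, and p_min ≥ 3 gives log N ≥ 1 in the noise bound.
  refine ⟨CB + (CP + CE * CR), by positivity, 1, 3, ?_⟩
  intro n p hn hp x hx w hw h hh hhh₀ μ hμ Ω _ P _ Z ε hN
  have hh0 : 0 < h := lt_of_le_of_lt (by positivity) hh
  have hh1 : h ≤ 1 := hhh₀.trans hh₀'
  have hgrid : 0 < gridSize p := by
    have := hp.trans (pMin_le_gridSize hd)
    omega
  obtain ⟨F, hFm, hF, hFE⟩ := herr hx hw hn hp hh hhh₀ hh1 hζ hσ hN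
  have hproc' := hproc hx hs hw hn hgrid hh hhh₀ hh1 hN
  set rate := upperRate s α L ζ σ CZ β₁ n p h with hrate
  set A := L * h ^ (α - (multiLength s : ℝ)) with hA
  set B := ζ * σ * √(Real.log h⁻¹ / (n * gridSize p * h ^ (d + 2 * multiLength s))) with hB
  set V := CZ / (√n * h ^ ((multiLength s : ℝ) - min (multiLength s : ℝ) β₁)) with hV
  have hABr : max A B ≤ rate := le_max_left _ _
  have hAr : A ≤ rate := (le_max_left _ _).trans hABr
  have hVr : V ≤ rate := le_max_right _ _
  have hrate0 : 0 ≤ rate := le_trans (by positivity) hAr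
  have hbias : cubeSupNorm (fun y => ∑ j, w h y j * μ (gridPoint x j) - partialDeriv s μ y) ≤
      ENNReal.ofReal (CB * rate) := by
    refine iSup₂_le fun y hy => ENNReal.ofReal_le_ofReal ?_
    have h1 := hw.abs_sum_mul_sub_le hx hc hC₁ hgrid hh hhh₀ hd hα hμ hL.le le_rfl le_rfl hy
    have h2 : (strictFloor α : ℝ) + min 1 (α - strictFloor α) = α := by
      rw [min_eq_right (by have := le_strictFloor_add_one (α := α); linarith)]
      ring
    rw [if_pos hs, h2, mul_assoc] at h1
    exact h1.trans (mul_le_mul_of_nonneg_left hAr hCB0.le)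
  have herror : ∫⁻ ω, F ω ∂P ≤ ENNReal.ofReal (CE * CR * rate) := by
    refine hFE.trans (ENNReal.ofReal_le_ofReal ?_)
    rw [mul_assoc CE]
    refine mul_le_mul_of_nonneg_left ?_ hCE.le
    exact (error_rate_le hα hL hζ hσ hh0 hn hgrid).trans
      (mul_le_mul_of_nonneg_left hABr hCR0.le)
  have hpt : ∀ ω, cubeSupNorm (fun y =>
      linearEstimator w (observation x μ Z ε) h y ω - partialDeriv s μ y) ≤
      ENNReal.ofReal (CB * rate) + (ENNReal.ofReal (1 / n) *
        cubeSupNorm (fun y => ∑ i, ∑ j, w h y j * Z i ω (gridPoint x j)) + F ω) := by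
    intro ω
    simp only [linearEstimator_observation_sub_eq hn]
    refine (cubeSupNorm_add_le _ _).trans (add_le_add hbias ((cubeSupNorm_add_le _ _).trans
      (add_le_add (cubeSupNorm_const_mul_le (by positivity) _) (hF ω))))
  refine (lintegral_mono hpt).trans ?_
  -- Measurability of the constant and of `F` suffices to split the integral; the supremum of the
  -- process term needs none.
  rw [lintegral_add_left measurable_const, lintegral_add_right _ hFm, lintegral_const,
    measure_univ, mul_one, add_mul, add_mul, ENNReal.ofReal_add (by positivity) (by positivity),
    ENNReal.ofReal_add (by positivity) (by positivity)]
  refine add_le_add le_rfl (add_le_add (hproc'.trans (ENNReal.ofReal_le_ofReal ?_)) herror)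
  exact mul_le_mul_of_nonneg_left hVr hCP.le
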